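/- Let $n\ge 0$. Let $\mathfrak{so}(n,\mathbb C)$ be the Lie algebra of complex skew-symmetric $n\times n$ matrices, with the Hermitian form $\langle A,B\rangle=-\tfrac12\operatorname{tr}(A\bar B)$, on which $SO(n,\mathbb C)$ acts by conjugation. Let $(\cdot,\cdot)$ be the complex bilinear extension of the Euclidean inner product to $\mathbb C^n$, and for $u,v\in\mathbb C^n$ let $X(u,v)\in\mathfrak{so}(n,\mathbb C)$ be the endomorphism $x\mapsto (u,x)v-(v,x)u$. For a Riemannian $n$-manifold $(M,g)$ and $p\in M$, a linear isometry $L:T_pM\to\mathbb R^n$ identifies $\wedge^2T_pM$ with $\mathfrak{so}(n)$ by $a\wedge b\mapsto X(La,Lb)$; the complex linear extension to $\mathfrak{so}(n,\mathbb C)$ of the curvature operator of $M$ at $p$ is again denoted by $R$ (with the sign for which $\langle R(X(La,Lb)),X(La,Lb)\rangle$ is the sectional curvature of the plane spanned by orthonormal $a,b$). For a subset $S\subset\mathfrak{so}(n,\mathbb C)$, $M$ has positive $S$-curvature if at every $p\in M$, for some such isometry $L$, $\langle R(X),X\rangle>0$ for all nonzero $X\in S$. An $m$-dimensional Riemannian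 manifold has nonnegative isotropic curvature if at every point, for every such isometry, $\langle R(X),X\rangle\ge 0$ for all $X\in\mathfrak{so}(m,\mathbb C)$ with $\operatorname{rank}X=2$ and $X^2=0$. **Corollary.** Let $S\subset\mathfrak{so}(n,\mathbb C)$ be invariant under the adjoint action of $SO(n,\mathbb C)$ and suppose that $S$ contains a nonzero element of the form $X(e,u)$ with $e\in\mathbb R^n$, $u\in\mathbb C^n$ and $(e,u)=0$. Let $(M,g)$ be a smooth Riemannian $n$-manifold with positive $S$-curvature. Then $M\times\mathbb R$ with the product metric $g+ds^2$ has nonnegative isotropic curvature. Moreover, $M$ is locally de Rham irreducible: no nonempty open subset of $M$ is isometric to a Riemannian product $N_1\times N_2$ of two Riemannian manifolds of positive dimension. -/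

import Mathlib

open scoped Manifold ContDiff Matrix Bundle

universe u v w

noncomputable section

/-! ### Curvature of a Riemannian metric, in the preferred charts of the manifold

The Levi-Civita connection and its curvature are written in coordinates.  As usual in Mathlib the
tangent space at `p` is the model vector space `E`, identified through the preferred chart at `p`,
so the coordinate expression of the curvature at `p` in that chart is a tensor on `T_pM`. -/

section Coordinates

variable {E : Type*} [NormedAddCommGroup E] [NormedSpace ℝ E]

/-- The Christoffel symbols of the first kind of the metric coefficients `G` at `y`: the functional
`w ↦ (∂_a G(b, w) + ∂_b G(a, w) - ∂_w G(a, b)) / 2`. -/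
def christoffelLower (G : E → E →L[ℝ] E →L[ℝ] ℝ) (y a b : E) : E →L[ℝ] ℝ :=
  (1 / 2 : ℝ) •
    (fderiv ℝ G y a b + fderiv ℝ G y b a - ((fderiv ℝ G y).flip a).flip b)

/-- The Christoffel symbols of the second kind: the vector `Γ_y(a, b)` with
`G_y(Γ_y(a, b), w) = (∂_a G(b, w) + ∂_b G(a, w) - ∂_w G(a, b)) / 2` for all `w`.
Here `(G y).inverse` is the inverse of the isomorphism `E → E^*` given by the metric at `y`. -/
def christoffel (G : E → E →L[ℝ] E →L[ℝ] ℝ) (y a b : E) : E :=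
  (G y).inverse (christoffelLower G y a b)

/-- The Riemann curvature endomorphism
`R(a, b) c = ∇_a ∇_b c - ∇_b ∇_a c` (for constant, hence commuting, coordinate fields `a, b, c`). -/
def coordRiemann (G : E → E →L[ℝ] E →L[ℝ] ℝ) (y a b c : E) : E :=
  fderiv ℝ (fun z => christoffel G z b c) y a - fderiv ℝ (fun z => christoffel G z a c) y b
    + christoffel G y a (christoffel G y b c) - christoffel G y b (christoffel G y a c)

end Coordinates

section Manifolds

variable {E : Type*} [NormedAddCommGroup E] [NormedSpace ℝ E]
  {H : Type*} [TopologicalSpace H] (I : ModelWithCorners ℝ E H)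
  {M : Type*} [TopologicalSpace M] [ChartedSpace H M]

/-- A field of bilinear forms on the tangent spaces. -/
abbrev MetricField (I : ModelWithCorners ℝ E H) (M : Type*) [TopologicalSpace M]
    [ChartedSpace H M] : Type _ :=
  ∀ x : M, TangentSpace I x →L[ℝ] TangentSpace I x →L[ℝ] ℝ

variable {I}

/-- The coefficients of `g` in the preferred chart `φ` at `p`:
`G_y(a, b) = g_{φ⁻¹ y}(dφ⁻¹_y a, dφ⁻¹_y b)`. -/
def chartMetric (g : MetricField I M) (p : M) (y : E) : E →L[ℝ] E →L[ℝ] ℝ :=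
  let A : E →L[ℝ] E := mfderiv 𝓘(ℝ, E) I (extChartAt I p).symm y
  let B : E →L[ℝ] E →L[ℝ] ℝ := g ((extChartAt I p).symm y)
  B.bilinearComp A A

/-- The curvature quantity `R(a, b, c, d) = ⟨R(a ∧ b), c ∧ d⟩ = g(R(a, b) d, c)` at `p`; with this
sign `R(a, b, a, b)` is the sectional curvature of the plane spanned by orthonormal `a, b`. -/
def riemannTensor (g : MetricField I M) (p : M) (a b c d : TangentSpace I p) : ℝ :=
  g p (coordRiemann (chartMetric g p) (extChartAt I p p) a b d : E) c

variable {E' : Type*} [NormedAddCommGroup E'] [NormedSpace ℝ E']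
  {H' : Type*} [TopologicalSpace H'] {I' : ModelWithCorners ℝ E' H'}
  {N : Type*} [TopologicalSpace N] [ChartedSpace H' N]

/-- The product metric `g + h` on `M × N`:
`((a, b), (a', b')) ↦ g(a, a') + h(b, b')`. -/
def productMetric (g : MetricField I M) (h : MetricField I' N) :
    MetricField (I.prod I') (M × N) := fun x =>
  let B : E →L[ℝ] E →L[ℝ] ℝ := g x.1
  let B' : E' →L[ℝ] E' →L[ℝ] ℝ := h x.2
  let C : (E × E') →L[ℝ] (E × E') →L[ℝ] ℝ :=
    B.bilinearComp (ContinuousLinearMap.fst ℝ E E') (ContinuousLinearMap.fst ℝ E E')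
      + B'.bilinearComp (ContinuousLinearMap.snd ℝ E E') (ContinuousLinearMap.snd ℝ E E')
  C

theorem productMetric_apply (g : MetricField I M) (h : MetricField I' N) (x : M × N)
    (a b : TangentSpace (I.prod I') x) :
    productMetric g h x a b = g x.1 a.1 b.1 + h x.2 a.2 b.2 := rfl

/-- The standard metric `ds²` of the real line. -/
def lineMetric : MetricField 𝓘(ℝ, ℝ) ℝ := fun _ => ContinuousLinearMap.mul ℝ ℝ

end Manifolds

/-- A smooth Riemannian metric on a smooth `n`-manifold. -/
abbrev SmoothMetric (n : ℕ) (M : Type*) [TopologicalSpace M]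
    [ChartedSpace (EuclideanSpace ℝ (Fin n)) M] [IsManifold (𝓡 n) ∞ M] : Type _ :=
  Bundle.ContMDiffRiemannianMetric (𝓡 n) ∞ (EuclideanSpace ℝ (Fin n))
    (fun x : M => TangentSpace (𝓡 n) x)

/-! ### The Lie algebra `so(n, ℂ)` and curvature operators -/

/-- The element `X(u, v) = φ(u ∧ v)` of `so(n, ℂ)`, that is, the matrix of the endomorphism
`x ↦ (u, x) v - (v, x) u`, with `( , )` the complex bilinear product. -/
def simpleElement {n : ℕ} (u v : Fin n → ℂ) : Matrix (Fin n) (Fin n) ℂ :=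
  Matrix.vecMulVec v u - Matrix.vecMulVec u v

theorem simpleElement_mulVec {n : ℕ} (u v x : Fin n → ℂ) :
    simpleElement u v *ᵥ x = (u ⬝ᵥ x) • v - (v ⬝ᵥ x) • u := by
  ext i
  simp [simpleElement, Matrix.sub_mulVec, Matrix.vecMulVec_mulVec, mul_comm]

/-- The vectors of the standard basis of `ℂⁿ`. -/
def stdVec {n : ℕ} (i : Fin n) : Fin n → ℂ := Pi.single i 1

/-- The Hermitian extension `⟨A, B⟩ = - tr(A B̄) / 2` to `so(n, ℂ)` of the inner product
`- tr(A B) / 2` of `so(n)`; the elements `X(e_i, e_j)`, `i < j`, form an orthonormal basis. -/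
def soInner {n : ℕ} (A B : Matrix (Fin n) (Fin n) ℂ) : ℂ :=
  -(1 / 2) * (A * B.map (starRingEnd ℂ)).trace

/-- Invariance of `S` under the adjoint action of `SO(n, ℂ)`. -/
def IsAdInvariant {n : ℕ} (S : Set (Matrix (Fin n) (Fin n) ℂ)) : Prop :=
  ∀ P ∈ Matrix.specialOrthogonalGroup (Fin n) ℂ, ∀ X ∈ S, P * X * P⁻¹ ∈ S

section CurvatureOperator

variable {E : Type*} [NormedAddCommGroup E] [NormedSpace ℝ E]
  {H : Type*} [TopologicalSpace H] {I : ModelWithCorners ℝ E H}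
  {M : Type*} [TopologicalSpace M] [ChartedSpace H M]

/-- A linear isometry from `(T_pM, g_p)` onto Euclidean space `ℝⁿ`. -/
structure TangentIsometry (g : MetricField I M) (p : M) (n : ℕ) where
  toEquiv : TangentSpace I p ≃ₗ[ℝ] (Fin n → ℝ)
  isometry : ∀ a b : TangentSpace I p, toEquiv a ⬝ᵥ toEquiv b = g p a b

/-- The component `⟨R(e_i ∧ e_j), e_k ∧ e_l⟩` of the curvature in the orthonormal basis of `T_pM`
that the isometry `L` carries to the standard basis of `ℝⁿ`. -/
def curvatureComponent {g : MetricField I M} {p : M} {n : ℕ} (L : TangentIsometry g p n)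
    (i j k l : Fin n) : ℝ :=
  riemannTensor g p (L.toEquiv.symm (Pi.single i 1)) (L.toEquiv.symm (Pi.single j 1))
    (L.toEquiv.symm (Pi.single k 1)) (L.toEquiv.symm (Pi.single l 1))

/-- The curvature operator at `p`, transported to `so(n)` by `φ ∘ (L ∧ L)` and extended complex
linearly to `so(n, ℂ)`: the operator `R` with `⟨R(X(e_i, e_j)), X(e_k, e_l)⟩ = R_{ijkl}`. -/
def curvatureOperator {g : MetricField I M} {p : M} {n : ℕ} (L : TangentIsometry g p n)
    (X : Matrix (Fin n) (Fin n) ℂ) : Matrix (Fin n) (Fin n) ℂ :=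
  ∑ i, ∑ j, ∑ k, ∑ l,
    if i < j ∧ k < l then
      (soInner X (simpleElement (stdVec i) (stdVec j)) * (curvatureComponent L i j k l : ℂ)) •
        simpleElement (stdVec k) (stdVec l)
    else 0

/-- Positive `S`-curvature: at each point, for a suitable identification of `T_pM` with `ℝⁿ`, the
(real) number `⟨R(X), X⟩` is positive for every nonzero `X ∈ S`. -/
def HasPositiveCurvatureOn {n : ℕ} (S : Set (Matrix (Fin n) (Fin n) ℂ)) (g : MetricField I M) :
    Prop :=
  ∀ p : M, ∃ L : TangentIsometry g p n,
    ∀ X ∈ S, X ≠ 0 → 0 < (soInner (curvatureOperator L X) X).re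

/-- The set `S₀ = {X ∈ so(m, ℂ) : rank X = 2, X² = 0}`. -/
def isotropicSet (m : ℕ) : Set (Matrix (Fin m) (Fin m) ℂ) :=
  {X | X ∈ LieAlgebra.Orthogonal.so (Fin m) ℂ ∧ X.rank = 2 ∧ X * X = 0}

/-- Nonnegative isotropic curvature of an `m`-dimensional manifold: `⟨R(X), X⟩ ≥ 0` for all
`X ∈ S₀`, at each point and for each identification of the tangent space with `ℝᵐ`. -/
def HasNonnegIsotropicCurvature (m : ℕ) (g : MetricField I M) : Prop :=
  ∀ (p : M) (L : TangentIsometry g p m),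
    ∀ X ∈ isotropicSet m, 0 ≤ (soInner (curvatureOperator L X) X).re

end CurvatureOperator

/-- Local de Rham irreducibility: no nonempty open subset of `M` is isometric to a Riemannian
product `N₁ × N₂` of two manifolds of positive dimension.  An injective local diffeomorphism is
the same as a diffeomorphism onto an open subset. -/
def IsLocallyIrreducible {n : ℕ} {M : Type u} [TopologicalSpace M]
    [ChartedSpace (EuclideanSpace ℝ (Fin n)) M] [IsManifold (𝓡 n) ∞ M]
    (g : SmoothMetric n M) : Prop :=
  ∀ (k l : ℕ) (N₁ : Type v) (N₂ : Type w) [Nonempty N₁] [Nonempty N₂]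
    [TopologicalSpace N₁] [ChartedSpace (EuclideanSpace ℝ (Fin k)) N₁] [IsManifold (𝓡 k) ∞ N₁]
    [TopologicalSpace N₂] [ChartedSpace (EuclideanSpace ℝ (Fin l)) N₂] [IsManifold (𝓡 l) ∞ N₂]
    (g₁ : SmoothMetric k N₁) (g₂ : SmoothMetric l N₂) (f : N₁ × N₂ → M),
    0 < k → 0 < l →
    ¬ (Function.Injective f ∧
        IsLocalDiffeomorph ((𝓡 k).prod (𝓡 l)) (𝓡 n) ∞ f ∧
        ∀ (x : N₁ × N₂) (a b : TangentSpace ((𝓡 k).prod (𝓡 l)) x),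
          g.inner (f x) (mfderiv ((𝓡 k).prod (𝓡 l)) (𝓡 n) f x a)
              (mfderiv ((𝓡 k).prod (𝓡 l)) (𝓡 n) f x b)
            = productMetric g₁.inner g₂.inner x a b)

end

/-!
Write `F(X) = ⟨R(X), X⟩` for the Hermitian form of the curvature operator at a point; it satisfies
`F(c X) = |c|² F(X)`.

*Orbits.*  Let `X(e, u) ∈ S` with `e` real, `e ⊥ u`, `u ≠ 0`.  Reflections act transitively enough
on pairs of perpendicular vectors (`exists_orthogonal_mulVec_pair`, a case of Witt's theorem) that
every `X(a, b)` with `a` non-isotropic, `b ⊥ a` nonzero, and `b` isotropic exactly when `u` is,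
has a nonzero multiple in the orbit of `X(e, u)` under `SO(n, ℂ)`; hence `F(X(a, b)) > 0`
(`pos_simpleElement_of_isAdInvariant`).  Each `X(v, w)` with `v` isotropic and `w ⊥ v` is a limit
of such elements, so `F(X(v, w)) ≥ 0` (`nonneg_simpleElement_of_isAdInvariant`).

*Isotropic curvature of `M × ℝ`.*  An element of rank two and square zero is `X(v, w)` with `v`,
`w` spanning a totally isotropic plane of `ℂⁿ⁺¹`.  That plane meets the complexified tangent space
of `M`, which is a hyperplane, so one may take `v` tangent to `M`.  The curvature of `M × ℝ`
depends only on the projections to `M`, and the projection of `w` is still perpendicular to `v`: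
the second point of the previous paragraph applies
(`hasNonnegIsotropicCurvature_productMetric_lineMetric`).

*Irreducibility.*  In a Riemannian product, `R(a, b, ·, ·) = 0` for `a`, `b` tangent to different
factors.  A local isometry from a product to `M` carries this splitting to `M`.  If `u` is
non-isotropic, `X(a, b)` with real `a`, `b` contradicts positivity.  If `u` is isotropic and one
factor has dimension at least two, `X(a, b + i c)` does, where `b`, `c` are perpendicular of equal
length in that factor; if both factors are lines, the curvature vanishes altogether, contradicting
`F(X(e, u)) > 0` (`false_of_orthogonal_splitting`).

Both parts need facts about the curvature tensor as computed in preferred charts: it is `4`-linear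
and skew-symmetric in the two pairs of arguments (`isCurvatureForm_riemannTensor`), additive on
products (`riemannTensor_productMetric`), and natural with respect to local isometries
(`riemannTensor_mfderiv`).  They are derived from the characterization of the Christoffel symbols
by the Koszul formula.
-/

set_option maxSynthPendingDepth 3
set_option linter.unusedSectionVars false

/-! ### Curvature of a metric in coordinates -/

section CoordinateCurvature

variable {E : Type*} [NormedAddCommGroup E] [NormedSpace ℝ E]

/-- `G` restricts to the coefficients of a smooth Riemannian metric on the open set `U`. -/
structure IsMetricOn (G : E → E →L[ℝ] E →L[ℝ] ℝ) (U : Set E) : Prop where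
  isOpen : IsOpen U
  contDiffOn : ContDiffOn ℝ ∞ G U
  symm : ∀ y ∈ U, ∀ a b, G y a b = G y b a
  pos : ∀ y ∈ U, ∀ a, a ≠ 0 → 0 < G y a a

/-- `christoffelLower` as a continuous bilinear map. -/
noncomputable def christoffelLowerL (G : E → E →L[ℝ] E →L[ℝ] ℝ) (y : E) :
    E →L[ℝ] E →L[ℝ] E →L[ℝ] ℝ :=
  (1 / 2 : ℝ) • (fderiv ℝ G y + (fderiv ℝ G y).flip
    - (ContinuousLinearMap.flipₗᵢ ℝ E E ℝ).toContinuousLinearEquiv.toContinuousLinearMap ∘L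
        (fderiv ℝ G y).flip)

/-- `christoffel` as a continuous bilinear map. -/
noncomputable def christoffelL (G : E → E →L[ℝ] E →L[ℝ] ℝ) (y : E) : E →L[ℝ] E →L[ℝ] E :=
  (ContinuousLinearMap.compL ℝ E (E →L[ℝ] ℝ) E (G y).inverse) ∘L christoffelLowerL G y

theorem christoffelLowerL_apply (G : E → E →L[ℝ] E →L[ℝ] ℝ) (y a b : E) :
    christoffelLowerL G y a b = christoffelLower G y a b := by
  ext w
  simp [christoffelLowerL, christoffelLower]

theorem christoffelL_apply (G : E → E →L[ℝ] E →L[ℝ] ℝ) (y a b : E) :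
    christoffelL G y a b = christoffel G y a b := by
  simp [christoffelL, christoffel, christoffelLowerL_apply]

theorem coordRiemann_congr {G G' : E → E →L[ℝ] E →L[ℝ] ℝ} {y : E}
    (h : G =ᶠ[nhds y] G') (a b c : E) : coordRiemann G y a b c = coordRiemann G' y a b c := by
  have h1 : ∀ a b, (fun z => christoffel G z a b) =ᶠ[nhds y] fun z => christoffel G' z a b := by
    intro a b
    filter_upwards [h, h.fderiv (𝕜 := ℝ)] with z hz hz'
    simp only [christoffel, christoffelLower, hz, hz']
  simp only [coordRiemann, (h1 _ _).fderiv_eq]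
  rw [(h1 b c).eq_of_nhds, (h1 a c).eq_of_nhds, (h1 a _).eq_of_nhds, (h1 b _).eq_of_nhds]

theorem coordRiemann_antisymm (G : E → E →L[ℝ] E →L[ℝ] ℝ) (y a b c : E) :
    coordRiemann G y a b c = -coordRiemann G y b a c := by
  simp only [coordRiemann]
  abel

variable [FiniteDimensional ℝ E]

namespace IsMetricOn

variable {G : E → E →L[ℝ] E →L[ℝ] ℝ} {U : Set E}

theorem isInvertible (h : IsMetricOn G U) {y : E} (hy : y ∈ U) : (G y).IsInvertible := by
  have hinj : Function.Injective ((G y : E →L[ℝ] E →L[ℝ] ℝ) : E →ₗ[ℝ] E →L[ℝ] ℝ) := by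
    rw [← LinearMap.ker_eq_bot, LinearMap.ker_eq_bot']
    intro a ha
    by_contra hne
    have := h.pos y hy a hne
    have h2 : G y a a = 0 := by
      have : G y a = 0 := ha
      simp [this]
    linarith
  have hdim : Module.finrank ℝ E = Module.finrank ℝ (E →L[ℝ] ℝ) := by
    rw [← (LinearMap.toContinuousLinearMap (𝕜 := ℝ) (E := E) (F' := ℝ)).finrank_eq]
    exact (Subspace.dual_finrank_eq (K := ℝ) (V := E)).symm
  refine ⟨(LinearEquiv.ofInjectiveOfFinrankEq _ hinj hdim).toContinuousLinearEquiv, ?_⟩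
  ext a b
  rfl

theorem eq_zero_of_forall (h : IsMetricOn G U) {y a : E} (hy : y ∈ U)
    (ha : ∀ b, G y a b = 0) : a = 0 := by
  by_contra hne
  have := h.pos y hy a hne
  rw [ha] at this
  exact lt_irrefl _ this

theorem contDiffAt (h : IsMetricOn G U) {y : E} (hy : y ∈ U) : ContDiffAt ℝ ∞ G y :=
  h.contDiffOn.contDiffAt (h.isOpen.mem_nhds hy)

theorem hasFDerivAt (h : IsMetricOn G U) {y : E} (hy : y ∈ U) :
    HasFDerivAt G (fderiv ℝ G y) y :=
  ((h.contDiffAt hy).differentiableAt (by simp)).hasFDerivAt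

theorem hasFDerivAt_apply (h : IsMetricOn G U) {y : E} (hy : y ∈ U) (b c : E) :
    HasFDerivAt (fun z => G z b c) (((fderiv ℝ G y).flip b).flip c) y := by
  have := ((h.hasFDerivAt hy).clm_apply (hasFDerivAt_const b y)).clm_apply
    (hasFDerivAt_const c y)
  convert! this using 1
  ext d
  simp

theorem contDiffAt_fderiv (h : IsMetricOn G U) {y : E} (hy : y ∈ U) :
    ContDiffAt ℝ ∞ (fderiv ℝ G) y :=
  (h.contDiffAt hy).fderiv_right (by simp)

theorem apply_christoffel (h : IsMetricOn G U) {y : E} (hy : y ∈ U) (a b w : E) :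
    G y (christoffel G y a b) w = christoffelLower G y a b w := by
  obtain ⟨e, he⟩ := h.isInvertible hy
  simp only [christoffel]
  rw [← he]
  simp

theorem two_mul_apply_christoffel (h : IsMetricOn G U) {y : E} (hy : y ∈ U) (a b w : E) :
    2 * G y (christoffel G y a b) w =
      fderiv ℝ G y a b w + fderiv ℝ G y b a w - fderiv ℝ G y w a b := by
  rw [h.apply_christoffel hy]
  simp [christoffelLower]

set_option synthInstance.maxHeartbeats 200000 in
theorem contDiffAt_christoffelL (h : IsMetricOn G U) {y : E} (hy : y ∈ U) :
    ContDiffAt ℝ ∞ (christoffelL G) y := by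
  have h1 : ContDiffAt ℝ ∞ (fun z => (G z).inverse) y :=
    ((h.isInvertible hy).contDiffAt_map_inverse).comp y (h.contDiffAt hy)
  have hD := h.contDiffAt_fderiv hy
  have hF : ContDiffAt ℝ ∞ (fun z => (fderiv ℝ G z).flip) y :=
    (ContinuousLinearMap.flipₗᵢ ℝ E E (E →L[ℝ] ℝ)).toContinuousLinearEquiv.contDiff.contDiffAt.comp
      y hD
  have h2 : ContDiffAt ℝ ∞ (christoffelLowerL G) y :=
    ((hD.add hF).sub (contDiffAt_const.clm_comp hF)).const_smul _
  have h3 : ContDiffAt ℝ ∞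
      (fun z => ContinuousLinearMap.compL ℝ E (E →L[ℝ] ℝ) E (G z).inverse) y :=
    contDiffAt_const.clm_apply h1
  exact h3.clm_comp h2

theorem hasFDerivAt_christoffelL (h : IsMetricOn G U) {y : E} (hy : y ∈ U) :
    HasFDerivAt (christoffelL G) (fderiv ℝ (christoffelL G) y) y :=
  ((h.contDiffAt_christoffelL hy).differentiableAt (by simp)).hasFDerivAt

theorem hasFDerivAt_christoffel (h : IsMetricOn G U) {y : E} (hy : y ∈ U) (b c : E) :
    HasFDerivAt (fun z => christoffel G z b c)
      (((fderiv ℝ (christoffelL G) y).flip b).flip c) y := by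
  have := ((h.hasFDerivAt_christoffelL hy).clm_apply (hasFDerivAt_const b y)).clm_apply
    (hasFDerivAt_const c y)
  simp only [christoffelL_apply] at this
  convert! this using 1
  ext d
  simp

theorem fderiv_symm (h : IsMetricOn G U) {y : E} (hy : y ∈ U) (a b c : E) :
    fderiv ℝ G y a b c = fderiv ℝ G y a c b := by
  have h2 : (fun z => G z b c) =ᶠ[nhds y] fun z => G z c b := by
    filter_upwards [h.isOpen.mem_nhds hy] with z hz using h.symm z hz b c
  have := (h.hasFDerivAt_apply hy b c).unique
    ((h.hasFDerivAt_apply hy c b).congr_of_eventuallyEq h2)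
  simpa using congrArg (fun f => f a) this

/-- The Levi-Civita connection is metric. -/
theorem fderiv_eq (h : IsMetricOn G U) {y : E} (hy : y ∈ U) (a b c : E) :
    fderiv ℝ G y a b c = G y (christoffel G y a b) c + G y b (christoffel G y a c) := by
  have h1 := h.two_mul_apply_christoffel hy a b c
  have h2 := h.two_mul_apply_christoffel hy a c b
  rw [h.symm y hy] at h2
  have := h.fderiv_symm hy a c b
  have := h.fderiv_symm hy b a c
  have := h.fderiv_symm hy c a b
  linarith

/-- The curvature in terms of the derivative of the bilinear map `christoffelL`; this form shows
that it is trilinear. -/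
theorem coordRiemann_eq (h : IsMetricOn G U) {y : E} (hy : y ∈ U) (a b c : E) :
    coordRiemann G y a b c =
      fderiv ℝ (christoffelL G) y a b c - fderiv ℝ (christoffelL G) y b a c
        + christoffelL G y a (christoffelL G y b c)
        - christoffelL G y b (christoffelL G y a c) := by
  simp only [coordRiemann, (h.hasFDerivAt_christoffel hy _ _).fderiv, christoffelL_apply,
    ContinuousLinearMap.flip_apply]

/-- The curvature endomorphisms are skew-symmetric: the second derivatives of the metric
coefficients commute, and the connection is metric. -/
theorem coordRiemann_skew (h : IsMetricOn G U) {y : E} (hy : y ∈ U) (a b c d : E) :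
    G y (coordRiemann G y a b c) d = -G y c (coordRiemann G y a b d) := by
  -- `fderiv_eq` differentiated once more
  have key : ∀ a b, fderiv ℝ (fderiv ℝ G) y a b c d =
      fderiv ℝ G y a (christoffelL G y b c) d + G y (fderiv ℝ (christoffelL G) y a b c) d
      + fderiv ℝ G y a c (christoffelL G y b d) + G y c (fderiv ℝ (christoffelL G) y a b d) := by
    intro a b
    have e : (fun z => fderiv ℝ G z b c d) =ᶠ[nhds y]
        fun z => G z (christoffelL G z b c) d + G z c (christoffelL G z b d) := by
      filter_upwards [h.isOpen.mem_nhds hy] with z hz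
      simp only [christoffelL_apply, h.fderiv_eq hz]
    have hD := (h.contDiffAt_fderiv hy).differentiableAt (by simp)
    have l := ((hD.hasFDerivAt.clm_apply (hasFDerivAt_const b y)).clm_apply
      (hasFDerivAt_const c y)).clm_apply (hasFDerivAt_const d y)
    have hC : ∀ c, HasFDerivAt (fun z => christoffelL G z b c) _ y := fun c =>
      ((h.hasFDerivAt_christoffelL hy).clm_apply (hasFDerivAt_const b y)).clm_apply
        (hasFDerivAt_const c y)
    have r1 := ((h.hasFDerivAt hy).clm_apply (hC c)).clm_apply (hasFDerivAt_const d y)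
    have r2 := ((h.hasFDerivAt hy).clm_apply (hasFDerivAt_const c y)).clm_apply (hC d)
    have := congrArg (fun f => f a) (l.unique ((r1.add r2).congr_of_eventuallyEq e))
    simp at this
    linarith
  have hs : fderiv ℝ (fderiv ℝ G) y a b = fderiv ℝ (fderiv ℝ G) y b a :=
    ((h.contDiffAt hy).isSymmSndFDerivAt
      (by simpa using (show ((2 : ℕ∞) : WithTop ℕ∞) ≤ ∞ from WithTop.coe_le_coe.2 le_top))).eq a b
  have k1 := key a b
  have k2 := key b a
  rw [hs, k2] at k1
  simp only [h.fderiv_eq hy, ← christoffelL_apply] at k1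
  simp only [h.coordRiemann_eq hy, map_add, map_sub, add_apply,
    sub_apply]
  linarith

end IsMetricOn

end CoordinateCurvature

/-! ### Products and naturality of the curvature in coordinates -/

section CoordinateNaturality

variable {E : Type*} [NormedAddCommGroup E] [NormedSpace ℝ E]
  {E' : Type*} [NormedAddCommGroup E'] [NormedSpace ℝ E']
  {G : E → E →L[ℝ] E →L[ℝ] ℝ} {U : Set E} {G' : E' → E' →L[ℝ] E' →L[ℝ] ℝ} {U' : Set E'}

/-- The coefficients of a product metric in a product chart. -/
noncomputable def prodCoeff (G : E → E →L[ℝ] E →L[ℝ] ℝ) (G' : E' → E' →L[ℝ] E' →L[ℝ] ℝ)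
    (y : E × E') :
    (E × E') →L[ℝ] (E × E') →L[ℝ] ℝ :=
  (G y.1).bilinearComp (ContinuousLinearMap.fst ℝ E E') (ContinuousLinearMap.fst ℝ E E')
    + (G' y.2).bilinearComp (ContinuousLinearMap.snd ℝ E E') (ContinuousLinearMap.snd ℝ E E')

theorem prodCoeff_apply (G : E → E →L[ℝ] E →L[ℝ] ℝ) (G' : E' → E' →L[ℝ] E' →L[ℝ] ℝ)
    (y a b : E × E') : prodCoeff G G' y a b = G y.1 a.1 b.1 + G' y.2 a.2 b.2 := rfl

variable [FiniteDimensional ℝ E] [FiniteDimensional ℝ E']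

namespace IsMetricOn

theorem prod (h : IsMetricOn G U) (h' : IsMetricOn G' U') :
    IsMetricOn (prodCoeff G G') (U ×ˢ U') where
  isOpen := h.isOpen.prod h'.isOpen
  contDiffOn := by
    rw [contDiffOn_clm_apply]
    intro a
    rw [contDiffOn_clm_apply]
    intro b
    have h1 := h.contDiffOn.comp (contDiffOn_fst (s := U ×ˢ U')) fun x hx => hx.1
    have h2 := h'.contDiffOn.comp (contDiffOn_snd (s := U ×ˢ U')) fun x hx => hx.2
    exact ((h1.clm_apply contDiffOn_const).clm_apply contDiffOn_const).add
      ((h2.clm_apply contDiffOn_const).clm_apply contDiffOn_const)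
  symm := fun y hy a b => by
    rw [prodCoeff_apply, prodCoeff_apply, h.symm _ hy.1, h'.symm _ hy.2]
  pos := fun y hy a ha => by
    rw [prodCoeff_apply]
    have n1 : 0 ≤ G y.1 a.1 a.1 := by
      by_cases h0 : a.1 = 0
      · simp [h0]
      · exact (h.pos _ hy.1 _ h0).le
    have n2 : 0 ≤ G' y.2 a.2 a.2 := by
      by_cases h0 : a.2 = 0
      · simp [h0]
      · exact (h'.pos _ hy.2 _ h0).le
    by_cases h0 : a.1 = 0
    · have : a.2 ≠ 0 := fun h1 => ha (Prod.ext h0 h1)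
      linarith [h'.pos _ hy.2 _ this]
    · linarith [h.pos _ hy.1 _ h0]

theorem christoffel_prod (h : IsMetricOn G U) (h' : IsMetricOn G' U') {y : E × E'}
    (hy : y ∈ U ×ˢ U') (a b : E × E') :
    christoffel (prodCoeff G G') y a b =
      (christoffel G y.1 a.1 b.1, christoffel G' y.2 a.2 b.2) := by
  have hp := h.prod h'
  have hD : ∀ a b c : E × E', fderiv ℝ (prodCoeff G G') y a b c =
      fderiv ℝ G y.1 a.1 b.1 c.1 + fderiv ℝ G' y.2 a.2 b.2 c.2 := by
    intro a b c
    have h1 := hp.hasFDerivAt_apply hy b c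
    have h2 := ((h.hasFDerivAt_apply hy.1 b.1 c.1).comp y hasFDerivAt_fst).add
      ((h'.hasFDerivAt_apply hy.2 b.2 c.2).comp y hasFDerivAt_snd)
    simpa using congrArg (fun f => f a) (h1.unique h2)
  rw [← sub_eq_zero]
  refine hp.eq_zero_of_forall hy fun c => ?_
  have h0 := hp.two_mul_apply_christoffel hy a b c
  have h1 := h.two_mul_apply_christoffel hy.1 a.1 b.1 c.1
  have h2 := h'.two_mul_apply_christoffel hy.2 a.2 b.2 c.2
  simp only [hD] at h0
  have h3 : prodCoeff G G' y (christoffel G y.1 a.1 b.1, christoffel G' y.2 a.2 b.2) c =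
      G y.1 (christoffel G y.1 a.1 b.1) c.1 + G' y.2 (christoffel G' y.2 a.2 b.2) c.2 := rfl
  rw [map_sub, sub_apply, h3]
  linarith

theorem coordRiemann_prod (h : IsMetricOn G U) (h' : IsMetricOn G' U') {y : E × E'}
    (hy : y ∈ U ×ˢ U') (a b c : E × E') :
    coordRiemann (prodCoeff G G') y a b c =
      (coordRiemann G y.1 a.1 b.1 c.1, coordRiemann G' y.2 a.2 b.2 c.2) := by
  have hD : ∀ a b c : E × E', fderiv ℝ (fun z => christoffel (prodCoeff G G') z b c) y a =
      (fderiv ℝ (fun z => christoffel G z b.1 c.1) y.1 a.1,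
        fderiv ℝ (fun z => christoffel G' z b.2 c.2) y.2 a.2) := by
    intro a b c
    have h1 := h.hasFDerivAt_christoffel hy.1 b.1 c.1
    have h2 := h'.hasFDerivAt_christoffel hy.2 b.2 c.2
    have e : (fun z => christoffel (prodCoeff G G') z b c) =ᶠ[nhds y]
        fun z => (christoffel G z.1 b.1 c.1, christoffel G' z.2 b.2 c.2) := by
      filter_upwards [(h.prod h').isOpen.mem_nhds hy] with z hz using h.christoffel_prod h' hz b c
    have h3 := (h1.comp y hasFDerivAt_fst).prodMk (h2.comp y hasFDerivAt_snd)
    rw [e.fderiv_eq, h1.fderiv, h2.fderiv]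
    exact congrArg (fun f => f a) h3.fderiv
  simp only [coordRiemann, hD, h.christoffel_prod h' hy]
  rfl

section Pullback

variable {φ : E' → E}

/-- Transformation rule of the Christoffel symbols under a local isometry.  Both sides are
compared by pairing with vectors in the range of the differential, so surjectivity of the latter
is enough. -/
theorem fderiv_christoffel (h : IsMetricOn G U) (h' : IsMetricOn G' U')
    (hφ : ContDiffOn ℝ ∞ φ U') (hmaps : Set.MapsTo φ U' U)
    (hiso : ∀ y ∈ U', ∀ a b, G' y a b = G (φ y) (fderiv ℝ φ y a) (fderiv ℝ φ y b))
    (hsurj : ∀ y ∈ U', Function.Surjective (fderiv ℝ φ y)) {y : E'} (hy : y ∈ U') (a b : E') :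
    fderiv ℝ φ y (christoffel G' y a b) = fderiv ℝ (fderiv ℝ φ) y a b
      + christoffel G (φ y) (fderiv ℝ φ y a) (fderiv ℝ φ y b) := by
  have cφ : ContDiffAt ℝ ∞ φ y := hφ.contDiffAt (h'.isOpen.mem_nhds hy)
  have dφ := (cφ.differentiableAt (by simp)).hasFDerivAt
  have ddφ := (((cφ.fderiv_right (m := ∞) (by simp))).differentiableAt (by simp)).hasFDerivAt
  have hs : ∀ a b, fderiv ℝ (fderiv ℝ φ) y a b = fderiv ℝ (fderiv ℝ φ) y b a :=
    (cφ.isSymmSndFDerivAt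
      (by simpa using (show ((2 : ℕ∞) : WithTop ℕ∞) ≤ ∞ from WithTop.coe_le_coe.2 le_top))).eq
  have hD : ∀ a b c, fderiv ℝ G' y a b c =
      fderiv ℝ G (φ y) (fderiv ℝ φ y a) (fderiv ℝ φ y b) (fderiv ℝ φ y c)
      + G (φ y) (fderiv ℝ (fderiv ℝ φ) y a b) (fderiv ℝ φ y c)
      + G (φ y) (fderiv ℝ φ y b) (fderiv ℝ (fderiv ℝ φ) y a c) := by
    intro a b c
    have hv : ∀ b, HasFDerivAt (fun z => fderiv ℝ φ z b) _ y := fun b =>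
      ddφ.clm_apply (hasFDerivAt_const b y)
    have r := (((h.hasFDerivAt (hmaps hy)).comp y dφ).clm_apply (hv b)).clm_apply (hv c)
    have e : (fun z => G' z b c) =ᶠ[nhds y]
        fun z => G (φ z) (fderiv ℝ φ z b) (fderiv ℝ φ z c) := by
      filter_upwards [h'.isOpen.mem_nhds hy] with z hz using hiso z hz b c
    have := congrArg (fun f => f a)
      ((h'.hasFDerivAt_apply hy b c).unique (r.congr_of_eventuallyEq e))
    simp at this
    linarith
  rw [← sub_eq_zero]
  refine h.eq_zero_of_forall (hmaps hy) fun w => ?_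
  obtain ⟨c, rfl⟩ := hsurj y hy w
  have h0 := h'.two_mul_apply_christoffel hy a b c
  rw [hiso y hy, hD a b c, hD b a c, hD c a b] at h0
  have h1 := h.two_mul_apply_christoffel (hmaps hy) (fderiv ℝ φ y a) (fderiv ℝ φ y b)
    (fderiv ℝ φ y c)
  rw [hs b a, hs c a, hs c b] at h0
  have h2 := h.symm _ (hmaps hy) (fderiv ℝ (fderiv ℝ φ) y a c) (fderiv ℝ φ y b)
  simp only [map_sub, map_add, sub_apply, add_apply]
  linarith

/-- The curvature is natural with respect to local isometries: in the derivative of the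
transformation rule of the Christoffel symbols, skew-symmetrized, the third derivatives of `φ`
cancel. -/
theorem fderiv_coordRiemann (h : IsMetricOn G U) (h' : IsMetricOn G' U')
    (hφ : ContDiffOn ℝ ∞ φ U') (hmaps : Set.MapsTo φ U' U)
    (hiso : ∀ y ∈ U', ∀ a b, G' y a b = G (φ y) (fderiv ℝ φ y a) (fderiv ℝ φ y b))
    (hsurj : ∀ y ∈ U', Function.Surjective (fderiv ℝ φ y)) {y : E'} (hy : y ∈ U')
    (a b c : E') :
    fderiv ℝ φ y (coordRiemann G' y a b c) =
      coordRiemann G (φ y) (fderiv ℝ φ y a) (fderiv ℝ φ y b) (fderiv ℝ φ y c) := by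
  have hΓ : ∀ {y}, y ∈ U' → ∀ a b, fderiv ℝ φ y (christoffelL G' y a b) =
      fderiv ℝ (fderiv ℝ φ) y a b
        + christoffelL G (φ y) (fderiv ℝ φ y a) (fderiv ℝ φ y b) := fun hy a b => by
    simpa only [christoffelL_apply] using h.fderiv_christoffel h' hφ hmaps hiso hsurj hy a b
  have cφ : ContDiffAt ℝ ∞ φ y := hφ.contDiffAt (h'.isOpen.mem_nhds hy)
  have cdφ : ContDiffAt ℝ ∞ (fderiv ℝ φ) y := cφ.fderiv_right (by simp)
  have dφ := (cφ.differentiableAt (by simp)).hasFDerivAt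
  have ddφ := (cdφ.differentiableAt (by simp)).hasFDerivAt
  have dddφ := ((cdφ.fderiv_right (m := ∞) (by simp)).differentiableAt (by simp)).hasFDerivAt
  have h2 : minSmoothness ℝ 2 ≤ (∞ : WithTop ℕ∞) := by
    simpa using (show ((2 : ℕ∞) : WithTop ℕ∞) ≤ ∞ from WithTop.coe_le_coe.2 le_top)
  have hs2 : ∀ a b, fderiv ℝ (fderiv ℝ φ) y a b = fderiv ℝ (fderiv ℝ φ) y b a :=
    (cφ.isSymmSndFDerivAt h2).eq
  have hs3 : fderiv ℝ (fderiv ℝ (fderiv ℝ φ)) y a b = fderiv ℝ (fderiv ℝ (fderiv ℝ φ)) y b a :=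
    (cdφ.isSymmSndFDerivAt h2).eq a b
  have key : ∀ a b, fderiv ℝ (fderiv ℝ φ) y a (christoffelL G' y b c)
      + fderiv ℝ φ y (fderiv ℝ (christoffelL G') y a b c) =
      fderiv ℝ (fderiv ℝ (fderiv ℝ φ)) y a b c
      + fderiv ℝ (christoffelL G) (φ y) (fderiv ℝ φ y a) (fderiv ℝ φ y b) (fderiv ℝ φ y c)
      + christoffelL G (φ y) (fderiv ℝ (fderiv ℝ φ) y a b) (fderiv ℝ φ y c)
      + christoffelL G (φ y) (fderiv ℝ φ y b) (fderiv ℝ (fderiv ℝ φ) y a c) := by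
    intro a b
    have hv : ∀ b, HasFDerivAt (fun z => fderiv ℝ φ z b) _ y := fun b =>
      ddφ.clm_apply (hasFDerivAt_const b y)
    have l := ddφ.clm_apply (((h'.hasFDerivAt_christoffelL hy).clm_apply
      (hasFDerivAt_const b y)).clm_apply (hasFDerivAt_const c y))
    have r1 := (dddφ.clm_apply (hasFDerivAt_const b y)).clm_apply (hasFDerivAt_const c y)
    have r2 := (((h.hasFDerivAt_christoffelL (hmaps hy)).comp y dφ).clm_apply (hv b)).clm_apply
      (hv c)
    have e : (fun z => fderiv ℝ φ z (christoffelL G' z b c)) =ᶠ[nhds y]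
        fun z => fderiv ℝ (fderiv ℝ φ) z b c
          + christoffelL G (φ z) (fderiv ℝ φ z b) (fderiv ℝ φ z c) := by
      filter_upwards [h'.isOpen.mem_nhds hy] with z hz using hΓ hz b c
    have := congrArg (fun f => f a) (l.unique ((r1.add r2).congr_of_eventuallyEq e))
    simp at this
    rw [add_comm, this]
    abel
  have k := congrArg₂ (· - ·) (key a b) (key b a)
  simp only [hs3, hs2 b a] at k
  rw [h'.coordRiemann_eq hy, h.coordRiemann_eq (hmaps hy)]
  simp only [map_add, map_sub, hΓ hy]
  rw [← sub_eq_zero] at k ⊢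
  rw [← k]
  abel

end Pullback

end IsMetricOn

end CoordinateNaturality

/-! ### The curvature tensor of a manifold -/

theorem IsMetricOn.congr {E : Type*} [NormedAddCommGroup E] [NormedSpace ℝ E]
    {G G' : E → E →L[ℝ] E →L[ℝ] ℝ} {U : Set E} (h : IsMetricOn G U)
    (e : ∀ y ∈ U, G' y = G y) : IsMetricOn G' U where
  isOpen := h.isOpen
  contDiffOn := h.contDiffOn.congr e
  symm := fun y hy => by rw [e y hy]; exact h.symm y hy
  pos := fun y hy => by rw [e y hy]; exact h.pos y hy

section ManifoldCurvature

variable {E : Type*} [NormedAddCommGroup E] [NormedSpace ℝ E] [FiniteDimensional ℝ E]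
  {H : Type*} [TopologicalSpace H] {I : ModelWithCorners ℝ E H} [I.Boundaryless]
  {M : Type*} [TopologicalSpace M] [ChartedSpace H M] [IsManifold I ∞ M]
  {E' : Type*} [NormedAddCommGroup E'] [NormedSpace ℝ E'] [FiniteDimensional ℝ E']
  {H' : Type*} [TopologicalSpace H'] {I' : ModelWithCorners ℝ E' H'} [I'.Boundaryless]
  {N : Type*} [TopologicalSpace N] [ChartedSpace H' N] [IsManifold I' ∞ N]

theorem isInvertible_mfderiv_extChartAt_symm {p : M} {y : E} (hy : y ∈ (extChartAt I p).target) :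
    (mfderiv 𝓘(ℝ, E) I (extChartAt I p).symm y).IsInvertible := by
  have := isInvertible_mfderivWithin_extChartAt_symm (I := I) hy
  rwa [I.range_eq_univ, mfderivWithin_univ] at this

/-- The identification of `T_pM` with the model space is the one through the preferred chart at `p`,
so that chart has the identity as differential at `p`. -/
theorem mfderiv_extChartAt_symm_self (p : M) :
    (mfderiv 𝓘(ℝ, E) I (extChartAt I p).symm (extChartAt I p p) : E →L[ℝ] E) =
      ContinuousLinearMap.id ℝ E := by
  have h1 := TangentBundle.symmL_trivializationAt (I := I) (mem_chart_source H p)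
  have h2 := TangentBundle.symmL_trivializationAt_eq_core (I := I) (𝕜 := ℝ)
    (mem_chart_source H p)
  rw [I.range_eq_univ, mfderivWithin_univ] at h1
  rw [h2] at h1
  refine Eq.trans h1.symm ?_
  ext v
  exact (tangentBundleCore I M).coordChange_self (achart H p) p (mem_chart_source H p) v

theorem chartMetric_apply (g : MetricField I M) (p : M) (y a b : E) :
    chartMetric g p y a b = g ((extChartAt I p).symm y)
      (mfderiv 𝓘(ℝ, E) I (extChartAt I p).symm y a)
      (mfderiv 𝓘(ℝ, E) I (extChartAt I p).symm y b) := rfl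

theorem chartMetric_self (g : MetricField I M) (p : M) (a b : E) :
    chartMetric g p (extChartAt I p p) a b = g p a b := by
  have h1 : ∀ a : E, (mfderiv 𝓘(ℝ, E) I (extChartAt I p).symm (extChartAt I p p) a : E) = a :=
    fun a => congrArg (fun f : E →L[ℝ] E => f a) (mfderiv_extChartAt_symm_self (I := I) p)
  let g' : M → E →L[ℝ] E →L[ℝ] ℝ := g
  change g' ((extChartAt I p).symm (extChartAt I p p)) _ _ = g' p a b
  erw [h1 a, h1 b]
  rw [extChartAt_to_inv]

/-- The coordinate vector fields of a chart are smooth. -/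
theorem contMDiffOn_mfderiv_extChartAt_symm (p : M) (a : E) :
    ContMDiffOn 𝓘(ℝ, E) I.tangent ∞
      (fun y => Bundle.TotalSpace.mk' E (E := fun x : M => TangentSpace I x)
        ((extChartAt I p).symm y) (mfderiv 𝓘(ℝ, E) I (extChartAt I p).symm y a))
      (extChartAt I p).target := by
  have hs : ContMDiffOn 𝓘(ℝ, E) I ∞ (extChartAt I p).symm (extChartAt I p).target :=
    contMDiffOn_extChartAt_symm p
  have h1 : ContMDiffOn 𝓘(ℝ, E) 𝓘(ℝ, E).tangent ∞
      (fun y : E => (⟨y, a⟩ : TangentBundle 𝓘(ℝ, E) E)) (extChartAt I p).target :=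
    contMDiffOn_vectorSpace_iff_contDiffOn.2 contDiffOn_const
  have h2 := hs.contMDiffOn_tangentMapWithin (m := ∞) (by simp)
    (isOpen_extChartAt_target p).uniqueMDiffOn
  refine (h2.comp h1 fun y hy => hy).congr fun y hy => ?_
  simp only [Function.comp, tangentMapWithin]
  rw [mfderivWithin_of_isOpen (isOpen_extChartAt_target p) hy]

theorem contDiffOn_chartMetric_apply
    (g : Bundle.ContMDiffRiemannianMetric I ∞ E (fun x : M => TangentSpace I x)) (p : M)
    (a b : E) : ContDiffOn ℝ ∞ (fun y => chartMetric g.inner p y a b) (extChartAt I p).target := by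
  have hs : ContMDiffOn 𝓘(ℝ, E) I ∞ (extChartAt I p).symm (extChartAt I p).target :=
    contMDiffOn_extChartAt_symm p
  intro y hy
  have h3 : ContMDiffWithinAt 𝓘(ℝ, E) (I.prod 𝓘(ℝ)) ∞
      (fun y => Bundle.TotalSpace.mk' ℝ (E := Bundle.Trivial M ℝ) ((extChartAt I p).symm y)
        (g.inner ((extChartAt I p).symm y)
          (mfderiv 𝓘(ℝ, E) I (extChartAt I p).symm y a)
          (mfderiv 𝓘(ℝ, E) I (extChartAt I p).symm y b))) (extChartAt I p).target y := by
    apply ContMDiffWithinAt.clm_bundle_apply₂ (F₁ := E) (F₂ := E)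
    · exact ContMDiffAt.comp_contMDiffWithinAt y g.contMDiff.contMDiffAt (hs y hy)
    · exact contMDiffOn_mfderiv_extChartAt_symm p a y hy
    · exact contMDiffOn_mfderiv_extChartAt_symm p b y hy
  rw [Bundle.contMDiffWithinAt_totalSpace] at h3
  exact h3.2.contDiffWithinAt

theorem chartMetric_symm (g : MetricField I M)
    (hg : ∀ x (v w : TangentSpace I x), g x v w = g x w v) (p : M) (y a b : E) :
    chartMetric g p y a b = chartMetric g p y b a := by
  rw [chartMetric_apply, chartMetric_apply]
  exact hg _ _ _

theorem chartMetric_pos (g : MetricField I M)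
    (hg : ∀ x (v : TangentSpace I x), v ≠ 0 → 0 < g x v v) (p : M) {y : E}
    (hy : y ∈ (extChartAt I p).target) {a : E} (ha : a ≠ 0) :
    0 < chartMetric g p y a a := by
  refine hg _ _ fun h0 => ha ?_
  obtain ⟨e, he⟩ := isInvertible_mfderiv_extChartAt_symm (I := I) hy
  rw [← he] at h0
  exact e.map_eq_zero_iff.1 h0

/-- The coefficients of a smooth Riemannian metric in a chart. -/
theorem isMetricOn_chartMetric
    (g : Bundle.ContMDiffRiemannianMetric I ∞ E (fun x : M => TangentSpace I x)) (p : M) :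
    IsMetricOn (chartMetric g.inner p) (extChartAt I p).target where
  isOpen := isOpen_extChartAt_target p
  contDiffOn := by
    rw [contDiffOn_clm_apply]
    intro a
    rw [contDiffOn_clm_apply]
    intro b
    exact contDiffOn_chartMetric_apply g p a b
  symm := fun y _ a b => chartMetric_symm g.inner g.symm p y a b
  pos := fun y hy a ha => chartMetric_pos g.inner g.pos p hy ha

theorem chartMetric_productMetric (g : MetricField I M) (h : MetricField I' N) (p : M × N)
    {y : E × E'} (hy : y ∈ (extChartAt (I.prod I') p).target) :
    chartMetric (productMetric g h) p y = prodCoeff (chartMetric g p.1) (chartMetric h p.2) y := by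
  have hy' : y.1 ∈ (extChartAt I p.1).target ∧ y.2 ∈ (extChartAt I' p.2).target := by
    rw [extChartAt_prod] at hy
    exact hy
  have hd1 : MDifferentiableAt 𝓘(ℝ, E) I (extChartAt I p.1).symm y.1 :=
    (contMDiffOn_extChartAt_symm (n := ∞) p.1).contMDiffAt
      ((isOpen_extChartAt_target p.1).mem_nhds hy'.1) |>.mdifferentiableAt (by simp)
  have hd2 : MDifferentiableAt 𝓘(ℝ, E') I' (extChartAt I' p.2).symm y.2 :=
    (contMDiffOn_extChartAt_symm (n := ∞) p.2).contMDiffAt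
      ((isOpen_extChartAt_target p.2).mem_nhds hy'.2) |>.mdifferentiableAt (by simp)
  have e : ((extChartAt (I.prod I') p).symm : E × E' → M × N) =
      Prod.map (extChartAt I p.1).symm (extChartAt I' p.2).symm := by
    rw [extChartAt_prod]
    rfl
  -- `𝓘(ℝ, E × E')` and `𝓘(ℝ, E).prod 𝓘(ℝ, E')` are propositionally but not reducibly equal
  have hm : (mfderiv 𝓘(ℝ, E × E') (I.prod I') (extChartAt (I.prod I') p).symm y :
      E × E' →L[ℝ] E × E') = ContinuousLinearMap.prodMap
        (mfderiv 𝓘(ℝ, E) I (extChartAt I p.1).symm y.1 : E →L[ℝ] E)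
        (mfderiv 𝓘(ℝ, E') I' (extChartAt I' p.2).symm y.2 : E' →L[ℝ] E') := by
    have key : ∀ F : E × E' → M × N,
        F = Prod.map (extChartAt I p.1).symm (extChartAt I' p.2).symm →
        (mfderiv (𝓘(ℝ, E).prod 𝓘(ℝ, E')) (I.prod I') F y : E × E' →L[ℝ] E × E') =
          ContinuousLinearMap.prodMap
            (mfderiv 𝓘(ℝ, E) I (extChartAt I p.1).symm y.1 : E →L[ℝ] E)
            (mfderiv 𝓘(ℝ, E') I' (extChartAt I' p.2).symm y.2 : E' →L[ℝ] E') := by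
      rintro _ rfl
      exact mfderiv_prodMap (p := y) hd1 hd2
    rw [modelWithCornersSelf_prod, ← chartedSpaceSelf_prod]
    exact key _ e
  have hm' : ∀ a : E × E', (mfderiv 𝓘(ℝ, E × E') (I.prod I') (extChartAt (I.prod I') p).symm y a :
      E × E') = ((mfderiv 𝓘(ℝ, E) I (extChartAt I p.1).symm y.1 a.1 : E),
        (mfderiv 𝓘(ℝ, E') I' (extChartAt I' p.2).symm y.2 a.2 : E')) := fun a =>
    congrArg (fun f : E × E' →L[ℝ] E × E' => f a) hm
  refine ContinuousLinearMap.ext fun a => ContinuousLinearMap.ext fun b => ?_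
  rw [prodCoeff_apply, chartMetric_apply, productMetric_apply]
  erw [hm' a, hm' b]
  rw [e]
  rfl

theorem IsMetricOn.chartMetric_prod {g : MetricField I M} {h : MetricField I' N} {p : M × N}
    (hg : IsMetricOn (chartMetric g p.1) (extChartAt I p.1).target)
    (hh : IsMetricOn (chartMetric h p.2) (extChartAt I' p.2).target) :
    IsMetricOn (chartMetric (productMetric g h) p) (extChartAt (I.prod I') p).target := by
  have e : (extChartAt (I.prod I') p).target =
      (extChartAt I p.1).target ×ˢ (extChartAt I' p.2).target := by
    rw [extChartAt_prod]
    rfl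
  have := hg.prod hh
  rw [← e] at this
  exact this.congr fun y hy => chartMetric_productMetric g h p hy

/-- The curvature tensor of a Riemannian product is the sum of those of the factors. -/
theorem riemannTensor_productMetric {g : MetricField I M} {h : MetricField I' N} {p : M × N}
    (hg : IsMetricOn (chartMetric g p.1) (extChartAt I p.1).target)
    (hh : IsMetricOn (chartMetric h p.2) (extChartAt I' p.2).target)
    (a b c d : TangentSpace (I.prod I') p) :
    riemannTensor (productMetric g h) p a b c d =
      riemannTensor g p.1 a.1 b.1 c.1 d.1 + riemannTensor h p.2 a.2 b.2 c.2 d.2 := by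
  have e : chartMetric (productMetric g h) p =ᶠ[nhds (extChartAt (I.prod I') p p)]
      prodCoeff (chartMetric g p.1) (chartMetric h p.2) := by
    filter_upwards [(isOpen_extChartAt_target (I := I.prod I') p).mem_nhds
      (mem_extChartAt_target p)] with y hy using chartMetric_productMetric g h p hy
  have hp : extChartAt (I.prod I') p p = (extChartAt I p.1 p.1, extChartAt I' p.2 p.2) := by
    rw [extChartAt_prod]
    rfl
  have key : ∀ a b d : E × E',
      coordRiemann (chartMetric (productMetric g h) p) (extChartAt (I.prod I') p p) a b d =
      (coordRiemann (chartMetric g p.1) (extChartAt I p.1 p.1) a.1 b.1 d.1,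
        coordRiemann (chartMetric h p.2) (extChartAt I' p.2 p.2) a.2 b.2 d.2) := by
    intro a b d
    rw [coordRiemann_congr e, hp]
    exact hg.coordRiemann_prod hh ⟨mem_extChartAt_target p.1, mem_extChartAt_target p.2⟩ a b d
  exact congrArg (fun v : E × E' => productMetric g h p v c) (key a b d)

/-- The curvature tensor is natural with respect to maps that preserve the metric and have
surjective differentials. -/
theorem riemannTensor_mfderiv {g : MetricField I M} {h : MetricField I' N} {f : N → M}
    (hg : ∀ p, IsMetricOn (chartMetric g p) (extChartAt I p).target)
    (hh : ∀ x, IsMetricOn (chartMetric h x) (extChartAt I' x).target)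
    (hf : ContMDiff I' I ∞ f) (hsurj : ∀ x, Function.Surjective (mfderiv I' I f x))
    (hiso : ∀ x (a b : TangentSpace I' x), g (f x) (mfderiv I' I f x a) (mfderiv I' I f x b) =
      h x a b) (x : N) (a b c d : TangentSpace I' x) :
    riemannTensor g (f x) (mfderiv I' I f x a) (mfderiv I' I f x b) (mfderiv I' I f x c)
      (mfderiv I' I f x d) = riemannTensor h x a b c d := by
  set φ : E' → E := writtenInExtChartAt I' I x f with hφdef
  set U' : Set E' := (extChartAt I' x).target ∩
    (extChartAt I' x).symm ⁻¹' (f ⁻¹' (extChartAt I (f x)).source) with hU'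
  have hopen : IsOpen U' :=
    (continuousOn_extChartAt_symm x).isOpen_inter_preimage (isOpen_extChartAt_target x)
      ((isOpen_extChartAt_source (f x)).preimage hf.continuous)
  have hx0 : extChartAt I' x x ∈ U' := ⟨mem_extChartAt_target x, by simp⟩
  have hmaps : Set.MapsTo φ U' (extChartAt I (f x)).target := fun y hy =>
    (extChartAt I (f x)).map_source hy.2
  have hs : ContMDiffOn 𝓘(ℝ, E') I' ∞ (extChartAt I' x).symm (extChartAt I' x).target :=
    contMDiffOn_extChartAt_symm x
  have hs' : ContMDiffOn 𝓘(ℝ, E) I ∞ (extChartAt I (f x)).symm (extChartAt I (f x)).target :=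
    contMDiffOn_extChartAt_symm (f x)
  have hφ : ContDiffOn ℝ ∞ φ U' := by
    rw [← contMDiffOn_iff_contDiffOn]
    exact (contMDiffOn_extChartAt (n := ∞) (I := I) (x := f x)).comp
      (hf.comp_contMDiffOn (hs.mono Set.inter_subset_left)) fun y hy => by
        simpa using hy.2
  have hdφ : ∀ y ∈ U', MDifferentiableAt 𝓘(ℝ, E') 𝓘(ℝ, E) φ y := fun y hy =>
    ((hφ.contDiffAt (hopen.mem_nhds hy)).differentiableAt (by simp)).mdifferentiableAt
  have hds : ∀ y ∈ (extChartAt I' x).target,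
      MDifferentiableAt 𝓘(ℝ, E') I' (extChartAt I' x).symm y := fun y hy =>
    (hs.contMDiffAt ((isOpen_extChartAt_target x).mem_nhds hy)).mdifferentiableAt (by simp)
  have hds' : ∀ y ∈ (extChartAt I (f x)).target,
      MDifferentiableAt 𝓘(ℝ, E) I (extChartAt I (f x)).symm y := fun y hy =>
    (hs'.contMDiffAt ((isOpen_extChartAt_target (f x)).mem_nhds hy)).mdifferentiableAt (by simp)
  -- the chain rule for `f ∘ (chart at x)⁻¹ = (chart at f x)⁻¹ ∘ φ`
  have chain : ∀ y ∈ U', ∀ a : E',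
      (mfderiv 𝓘(ℝ, E) I (extChartAt I (f x)).symm (φ y) (fderiv ℝ φ y a) : E) =
        (mfderiv I' I f ((extChartAt I' x).symm y)
          (mfderiv 𝓘(ℝ, E') I' (extChartAt I' x).symm y a) : E) := by
    intro y hy a
    have h1 := mfderiv_comp y (hds' _ (hmaps hy)) (hdφ y hy)
    have h2 := mfderiv_comp y (hf.mdifferentiableAt (by simp)) (hds y hy.1)
    have e : (extChartAt I (f x)).symm ∘ φ =ᶠ[nhds y] f ∘ (extChartAt I' x).symm := by
      filter_upwards [hopen.mem_nhds hy] with z hz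
      exact (extChartAt I (f x)).left_inv hz.2
    have h3 : (mfderiv 𝓘(ℝ, E') I ((extChartAt I (f x)).symm ∘ φ) y : E' →L[ℝ] E) =
      mfderiv 𝓘(ℝ, E') I (f ∘ (extChartAt I' x).symm) y := e.mfderiv_eq
    rw [mfderiv_eq_fderiv] at h1
    exact (congrArg (fun F : E' →L[ℝ] E => F a) h1).symm.trans
      ((congrArg (fun F : E' →L[ℝ] E => F a) h3).trans
        (congrArg (fun F : E' →L[ℝ] E => F a) h2))
  have hisoφ : ∀ y ∈ U', ∀ a b, chartMetric h x y a b =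
      chartMetric g (f x) (φ y) (fderiv ℝ φ y a) (fderiv ℝ φ y b) := by
    intro y hy a b
    have hp : (extChartAt I (f x)).symm (φ y) = f ((extChartAt I' x).symm y) :=
      (extChartAt I (f x)).left_inv hy.2
    let g' : M → E →L[ℝ] E →L[ℝ] ℝ := g
    calc chartMetric h x y a b
        = g' (f ((extChartAt I' x).symm y))
          (mfderiv I' I f ((extChartAt I' x).symm y)
            (mfderiv 𝓘(ℝ, E') I' (extChartAt I' x).symm y a) : E)
          (mfderiv I' I f ((extChartAt I' x).symm y)
            (mfderiv 𝓘(ℝ, E') I' (extChartAt I' x).symm y b) : E) := (hiso _ _ _).symm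
      _ = g' ((extChartAt I (f x)).symm (φ y))
          (mfderiv 𝓘(ℝ, E) I (extChartAt I (f x)).symm (φ y) (fderiv ℝ φ y a) : E)
          (mfderiv 𝓘(ℝ, E) I (extChartAt I (f x)).symm (φ y) (fderiv ℝ φ y b) : E) := by
        rw [chain y hy a, chain y hy b, hp]
      _ = _ := rfl
  have hsurjφ : ∀ y ∈ U', Function.Surjective (fderiv ℝ φ y) := by
    intro y hy w
    obtain ⟨v, hv⟩ := hsurj ((extChartAt I' x).symm y)
      (mfderiv 𝓘(ℝ, E) I (extChartAt I (f x)).symm (φ y) w : E)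
    obtain ⟨a, ha⟩ := (isInvertible_mfderiv_extChartAt_symm (I := I') hy.1).surjective v
    refine ⟨a, (isInvertible_mfderiv_extChartAt_symm (I := I) (hmaps hy)).injective ?_⟩
    refine (chain y hy a).trans (Eq.trans ?_ hv)
    rw [← ha]
  have hh' : IsMetricOn (chartMetric h x) U' :=
    ⟨hopen, (hh x).contDiffOn.mono Set.inter_subset_left, fun y hy => (hh x).symm y hy.1,
      fun y hy => (hh x).pos y hy.1⟩
  have key := (hg (f x)).fderiv_coordRiemann hh' hφ hmaps hisoφ hsurjφ hx0 a b d
  have hφx : φ (extChartAt I' x x) = extChartAt I (f x) (f x) := by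
    simp [hφdef, writtenInExtChartAt]
  have hDφ : (mfderiv I' I f x : E' →L[ℝ] E) = fderiv ℝ φ (extChartAt I' x x) := by
    have := hf.mdifferentiableAt (x := x) (by simp)
    rw [MDifferentiableAt.mfderiv this, I'.range_eq_univ, fderivWithin_univ]
  rw [hφx] at key
  have hDφ' : ∀ a : E', fderiv ℝ φ (extChartAt I' x x) a = mfderiv I' I f x a := fun a =>
    (congrArg (fun F : E' →L[ℝ] E => F a) hDφ).symm
  have key' : coordRiemann (chartMetric g (f x)) (extChartAt I (f x) (f x))
      (mfderiv I' I f x a : E) (mfderiv I' I f x b : E) (mfderiv I' I f x d : E) =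
      mfderiv I' I f x (coordRiemann (chartMetric h x) (extChartAt I' x x) a b d : E') := by
    refine Eq.trans ?_ (key.symm.trans (hDφ' _))
    exact congr (congr (congrArg (coordRiemann (chartMetric g (f x)) (extChartAt I (f x) (f x)))
      (hDφ' a).symm) (hDφ' b).symm) (hDφ' d).symm
  exact (congrArg (fun v : E => g (f x) v (mfderiv I' I f x c)) key').trans (hiso x _ _)

end ManifoldCurvature

/-! ### Curvature forms and the Hermitian form of the curvature operator -/

section CurvatureForms

variable {V : Type*} [AddCommGroup V] [Module ℝ V]

/-- A `4`-linear form that is skew-symmetric in its first two and in its last two arguments.  The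
remaining symmetries of a curvature tensor play no role here. -/
structure IsCurvatureForm (T : V → V → V → V → ℝ) : Prop where
  linear_first : ∀ b c d, IsLinearMap ℝ fun a => T a b c d
  linear_third : ∀ a b d, IsLinearMap ℝ fun c => T a b c d
  skew_left : ∀ a b c d, T a b c d = -T b a c d
  skew_right : ∀ a b c d, T a b c d = -T a b d c

namespace IsCurvatureForm

variable {T : V → V → V → V → ℝ}

theorem linear_second (h : IsCurvatureForm T) (a c d : V) : IsLinearMap ℝ fun b => T a b c d where
  map_add x y := by
    simp only [h.skew_left a, (h.linear_first a c d).map_add]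
    ring
  map_smul r x := by
    simp only [h.skew_left a, (h.linear_first a c d).map_smul, smul_neg]

theorem linear_fourth (h : IsCurvatureForm T) (a b c : V) : IsLinearMap ℝ fun d => T a b c d where
  map_add x y := by
    simp only [h.skew_right a b c, (h.linear_third a b c).map_add]
    ring
  map_smul r x := by
    simp only [h.skew_right a b c, (h.linear_third a b c).map_smul, smul_neg]

theorem apply_self_left (h : IsCurvatureForm T) (a c d : V) : T a a c d = 0 := by
  have := h.skew_left a a c d
  linarith

/-- A curvature form on a line vanishes. -/
theorem eq_zero_of_span_singleton (h : IsCurvatureForm T) {e : V}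
    (he : ∀ a : V, ∃ r : ℝ, a = r • e) (a b c d : V) : T a b c d = 0 := by
  obtain ⟨r, rfl⟩ := he a
  obtain ⟨s, rfl⟩ := he b
  rw [(h.linear_first _ c d).map_smul r e, (h.linear_second e c d).map_smul s e,
    h.apply_self_left, smul_zero, smul_zero]

theorem apply_sum (h : IsCurvatureForm T) {n : ℕ} (L : V ≃ₗ[ℝ] (Fin n → ℝ))
    (x y z t : Fin n → ℝ) :
    T (L.symm x) (L.symm y) (L.symm z) (L.symm t) =
      ∑ i, ∑ j, ∑ k, ∑ l, x i * y j * z k * t l *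
        T (L.symm (Pi.single i 1)) (L.symm (Pi.single j 1)) (L.symm (Pi.single k 1))
          (L.symm (Pi.single l 1)) := by
  have key : ∀ (f : V → ℝ) (_ : IsLinearMap ℝ f) (x : Fin n → ℝ),
      f (L.symm x) = ∑ i, x i * f (L.symm (Pi.single i 1)) := by
    intro f hf x
    have := LinearMap.pi_apply_eq_sum_univ ((hf.mk' f) ∘ₗ L.symm.toLinearMap) x
    have e : ∀ i : Fin n, (fun j => if i = j then (1 : ℝ) else 0) = Pi.single i 1 := by
      intro i
      ext j
      simp [Pi.single_apply, eq_comm]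
    simpa [e] using this
  rw [key _ (h.linear_first _ _ _)]
  refine Finset.sum_congr rfl fun i _ => ?_
  rw [key _ (h.linear_second _ _ _), Finset.mul_sum]
  refine Finset.sum_congr rfl fun j _ => ?_
  rw [key _ (h.linear_third _ _ _), Finset.mul_sum, Finset.mul_sum]
  refine Finset.sum_congr rfl fun k _ => ?_
  rw [key _ (h.linear_fourth _ _ _), Finset.mul_sum, Finset.mul_sum, Finset.mul_sum]
  refine Finset.sum_congr rfl fun l _ => ?_
  ring

end IsCurvatureForm

/-- For `v = v₁ + i v₂` and `w = w₁ + i w₂` in `V ⊗ ℂ`, the real part of `T(v, w, v̄, w̄)`, where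
`T` is extended complex linearly: writing `v ∧ w = α + i β` it is `T(α, α) + T(β, β)`. -/
noncomputable def complexSectional (T : V → V → V → V → ℝ) (v₁ v₂ w₁ w₂ : V) : ℝ :=
  (T v₁ w₁ v₁ w₁ - T v₁ w₁ v₂ w₂ - T v₂ w₂ v₁ w₁ + T v₂ w₂ v₂ w₂) +
    (T v₁ w₂ v₁ w₂ + T v₁ w₂ v₂ w₁ + T v₂ w₁ v₁ w₂ + T v₂ w₁ v₂ w₁)

end CurvatureForms

section Components

variable {n : ℕ}

theorem soInner_sum_left {ι : Type*} (s : Finset ι) (A : ι → Matrix (Fin n) (Fin n) ℂ)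
    (B : Matrix (Fin n) (Fin n) ℂ) : soInner (∑ i ∈ s, A i) B = ∑ i ∈ s, soInner (A i) B := by
  simp only [soInner, Finset.sum_mul, Matrix.trace_sum, Finset.mul_sum]

theorem soInner_smul_left (c : ℂ) (A B : Matrix (Fin n) (Fin n) ℂ) :
    soInner (c • A) B = c * soInner A B := by
  simp only [soInner, Matrix.smul_mul, Matrix.trace_smul, smul_eq_mul]
  ring

theorem soInner_simpleElement (u v u' v' : Fin n → ℂ) :
    soInner (simpleElement u v) (simpleElement u' v') =
      (u ⬝ᵥ star u') * (v ⬝ᵥ star v') - (u ⬝ᵥ star v') * (v ⬝ᵥ star u') := by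
  have e : (simpleElement u' v').map (starRingEnd ℂ) = simpleElement (star u') (star v') := by
    ext i j
    simp [simpleElement, Matrix.vecMulVec_apply]
  rw [soInner, e]
  simp only [simpleElement, sub_mul, mul_sub, Matrix.vecMulVec_mul_vecMulVec, Matrix.trace_sub,
    Matrix.trace_vecMulVec, dotProduct_smul, smul_eq_mul]
  rw [dotProduct_comm v (star u'), dotProduct_comm v (star v'), dotProduct_comm u (star u'),
    dotProduct_comm u (star v')]
  ring

/-- Summation over pairs `i < j` against a skew-symmetric array. -/
theorem sum_lt_sub_mul_eq_sum (f A : Fin n → Fin n → ℂ) (hA : ∀ i j, A i j = -A j i) :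
    (∑ i, ∑ j, if i < j then (f i j - f j i) * A i j else 0) = ∑ i, ∑ j, f i j * A i j := by
  have h1 : ∀ i j, f i j * A i j =
      (if i < j then f i j * A i j else 0) + (if j < i then f i j * A i j else 0) := by
    intro i j
    rcases lt_trichotomy i j with h | h | h
    · simp [h, h.not_gt]
    · subst h
      have : A i i = 0 := by
        have := hA i i
        linear_combination this / 2
      simp [this]
    · simp [h, h.not_gt]
  have h2 : (∑ i, ∑ j, if j < i then f i j * A i j else 0) =
      ∑ i, ∑ j, if i < j then f j i * A j i else 0 := Finset.sum_comm
  rw [Finset.sum_congr rfl fun i _ => Finset.sum_congr rfl fun j _ => h1 i j]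
  simp only [Finset.sum_add_distrib]
  rw [h2]
  simp only [← Finset.sum_add_distrib]
  refine Finset.sum_congr rfl fun i _ => Finset.sum_congr rfl fun j _ => ?_
  split_ifs
  · rw [hA j i]
    ring
  · simp

variable {E : Type*} [NormedAddCommGroup E] [NormedSpace ℝ E]
  {H : Type*} [TopologicalSpace H] {I : ModelWithCorners ℝ E H}
  {M : Type*} [TopologicalSpace M] [ChartedSpace H M]

theorem soInner_curvatureOperator_simpleElement {g : MetricField I M} {p : M}
    (L : TangentIsometry g p n) (hT : IsCurvatureForm (riemannTensor g p)) (v w : Fin n → ℂ) :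
    soInner (curvatureOperator L (simpleElement v w)) (simpleElement v w) =
      ∑ i, ∑ j, ∑ k, ∑ l, v i * w j * star (v k * w l) * (curvatureComponent L i j k l : ℂ) := by
  have hX : ∀ i j, soInner (simpleElement v w) (simpleElement (stdVec i) (stdVec j)) =
      v i * w j - v j * w i := by
    intro i j
    rw [soInner_simpleElement]
    simp [stdVec]
  have hX' : ∀ i j, soInner (simpleElement (stdVec i) (stdVec j)) (simpleElement v w) =
      star (v i * w j) - star (v j * w i) := by
    intro i j
    rw [soInner_simpleElement]
    simp [stdVec]
    ring
  have s1 : ∀ i j k l, curvatureComponent L i j k l = -curvatureComponent L j i k l :=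
    fun i j k l => hT.skew_left _ _ _ _
  have s2 : ∀ i j k l, curvatureComponent L i j k l = -curvatureComponent L i j l k :=
    fun i j k l => hT.skew_right _ _ _ _
  have e1 : soInner (curvatureOperator L (simpleElement v w)) (simpleElement v w) =
      ∑ i, ∑ j, if i < j then (v i * w j - v j * w i) *
        (∑ k, ∑ l, if k < l then (star (v k * w l) - star (v l * w k)) *
          (curvatureComponent L i j k l : ℂ) else 0) else 0 := by
    simp only [curvatureOperator, soInner_sum_left]
    refine Finset.sum_congr rfl fun i _ => Finset.sum_congr rfl fun j _ => ?_
    by_cases h : i < j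
    · simp only [h, true_and, if_true, Finset.mul_sum]
      refine Finset.sum_congr rfl fun k _ => Finset.sum_congr rfl fun l _ => ?_
      split_ifs
      · rw [soInner_smul_left, hX, hX']
        ring
      · simp [soInner]
    · simp [h, soInner]
  rw [e1]
  have e2 : ∀ i j, (∑ k, ∑ l, if k < l then (star (v k * w l) - star (v l * w k)) *
      (curvatureComponent L i j k l : ℂ) else 0) =
      ∑ k, ∑ l, star (v k * w l) * (curvatureComponent L i j k l : ℂ) := fun i j =>
    sum_lt_sub_mul_eq_sum (fun k l => star (v k * w l)) _ fun k l => by rw [s2]; push_cast; rfl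
  simp only [e2]
  rw [sum_lt_sub_mul_eq_sum (fun i j => v i * w j)
    (fun i j => ∑ k, ∑ l, star (v k * w l) * (curvatureComponent L i j k l : ℂ))]
  · simp only [Finset.mul_sum, mul_assoc]
  · intro i j
    simp only [← Finset.sum_neg_distrib]
    refine Finset.sum_congr rfl fun k _ => Finset.sum_congr rfl fun l _ => ?_
    rw [s1 i j]
    push_cast
    ring

/-- The Hermitian form of the curvature operator on simple elements, without reference to a
basis. -/
theorem re_soInner_curvatureOperator {g : MetricField I M} {p : M}
    (L : TangentIsometry g p n) (hT : IsCurvatureForm (riemannTensor g p)) (v w : Fin n → ℂ) :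
    (soInner (curvatureOperator L (simpleElement v w)) (simpleElement v w)).re =
      complexSectional (riemannTensor g p) (L.toEquiv.symm fun i => (v i).re)
        (L.toEquiv.symm fun i => (v i).im) (L.toEquiv.symm fun i => (w i).re)
        (L.toEquiv.symm fun i => (w i).im) := by
  rw [soInner_curvatureOperator_simpleElement L hT]
  have h := hT.apply_sum L.toEquiv
  rw [complexSectional, h, h, h, h, h, h, h, h]
  simp only [Complex.re_sum, ← Finset.sum_add_distrib, ← Finset.sum_sub_distrib]
  refine Finset.sum_congr rfl fun i _ => Finset.sum_congr rfl fun j _ =>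
    Finset.sum_congr rfl fun k _ => Finset.sum_congr rfl fun l _ => ?_
  simp only [curvatureComponent, Complex.mul_re, Complex.mul_im, Complex.star_def, map_mul,
    Complex.conj_re, Complex.conj_im, Complex.ofReal_re, Complex.ofReal_im]
  ring

end Components

section

variable {E : Type*} [NormedAddCommGroup E] [NormedSpace ℝ E] [FiniteDimensional ℝ E]
  {H : Type*} [TopologicalSpace H] {I : ModelWithCorners ℝ E H} [I.Boundaryless]
  {M : Type*} [TopologicalSpace M] [ChartedSpace H M] [IsManifold I ∞ M]

/-- Skew-symmetry in the last two arguments is `IsMetricOn.coordRiemann_skew`. -/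
theorem isCurvatureForm_riemannTensor {g : MetricField I M} {p : M}
    (hg : IsMetricOn (chartMetric g p) (extChartAt I p).target) :
    IsCurvatureForm (riemannTensor g p) := by
  have hp := mem_extChartAt_target (I := I) p
  have e : ∀ a b c d : E, riemannTensor g p a b c d = chartMetric g p (extChartAt I p p)
      (coordRiemann (chartMetric g p) (extChartAt I p p) a b d) c := fun a b c d =>
    (chartMetric_self g p _ c).symm
  have key : IsCurvatureForm (V := E) (fun a b c d => chartMetric g p (extChartAt I p p)
      (coordRiemann (chartMetric g p) (extChartAt I p p) a b d) c) :=
    { linear_first := fun b c d =>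
        ⟨fun x y => by
            simp only [hg.coordRiemann_eq hp, map_add, map_sub, add_apply, sub_apply]; ring,
          fun r x => by
            simp only [hg.coordRiemann_eq hp, map_add, map_sub, map_smul, add_apply, sub_apply,
              smul_apply, smul_eq_mul]
            ring⟩
      linear_third := fun a b d => ⟨fun x y => by simp, fun r x => by simp⟩
      skew_left := fun a b c d => by rw [coordRiemann_antisymm]; simp
      skew_right := fun a b c d => by
        rw [hg.coordRiemann_skew hp, hg.symm _ hp] }
  have : (riemannTensor g p : E → E → E → E → ℝ) = _ :=
    funext fun a => funext fun b => funext fun c => funext fun d => e a b c d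
  change IsCurvatureForm (V := E) (riemannTensor g p : E → E → E → E → ℝ)
  rw [this]
  exact key

theorem isMetricOn_chartMetric_lineMetric (s : ℝ) :
    IsMetricOn (chartMetric lineMetric s) (extChartAt 𝓘(ℝ, ℝ) s).target := by
  have e : ∀ y : ℝ, chartMetric lineMetric s y = ContinuousLinearMap.mul ℝ ℝ := by
    intro y
    have h : (mfderiv 𝓘(ℝ, ℝ) 𝓘(ℝ, ℝ) (extChartAt 𝓘(ℝ, ℝ) s).symm y : ℝ →L[ℝ] ℝ) =
        ContinuousLinearMap.id ℝ ℝ := by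
      rw [extChartAt_model_space_eq_id]
      exact mfderiv_id
    have h1 : ∀ a : ℝ, (mfderiv 𝓘(ℝ, ℝ) 𝓘(ℝ, ℝ) (extChartAt 𝓘(ℝ, ℝ) s).symm y a : ℝ) = a :=
      fun a => congrArg (fun F : ℝ →L[ℝ] ℝ => F a) h
    exact ContinuousLinearMap.ext fun a => ContinuousLinearMap.ext fun b =>
      congrArg₂ (fun a b : ℝ => a * b) (h1 a) (h1 b)
  refine ⟨isOpen_extChartAt_target s, ?_, ?_, ?_⟩
  · rw [funext e]
    exact contDiffOn_const
  · intro y _ a b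
    rw [e]
    exact mul_comm a b
  · intro y _ a ha
    rw [e]
    exact mul_self_pos.2 ha

/-- The curvature of `M × ℝ` only sees the components along `M`. -/
theorem riemannTensor_productMetric_lineMetric {g : MetricField I M} {p : M × ℝ}
    (hg : IsMetricOn (chartMetric g p.1) (extChartAt I p.1).target)
    (a b c d : TangentSpace (I.prod 𝓘(ℝ, ℝ)) p) :
    riemannTensor (productMetric g lineMetric) p a b c d =
      riemannTensor g p.1 a.1 b.1 c.1 d.1 := by
  rw [riemannTensor_productMetric hg (isMetricOn_chartMetric_lineMetric p.2)]
  have h := isCurvatureForm_riemannTensor (isMetricOn_chartMetric_lineMetric p.2)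
  have := h.eq_zero_of_span_singleton (e := (1 : ℝ)) (fun r : ℝ => ⟨r, (mul_one r).symm⟩)
    a.2 b.2 c.2 d.2
  rw [this, add_zero]

end

/-! ### Transitivity of the complex orthogonal group -/

section Orbits

variable {n : ℕ}

theorem simpleElement_smul_smul (c d : ℂ) (u v : Fin n → ℂ) :
    simpleElement (c • u) (d • v) = (c * d) • simpleElement u v := by
  ext i j
  simp [simpleElement, Matrix.vecMulVec_apply]
  ring

theorem simpleElement_swap (u v : Fin n → ℂ) : simpleElement u v = -simpleElement v u := by
  simp [simpleElement]

theorem mul_simpleElement_mul_transpose (P : Matrix (Fin n) (Fin n) ℂ) (u v : Fin n → ℂ) :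
    P * simpleElement u v * Pᵀ = simpleElement (P *ᵥ u) (P *ᵥ v) := by
  simp only [simpleElement, mul_sub, sub_mul, Matrix.mul_vecMulVec, Matrix.vecMulVec_mul,
    Matrix.vecMul_transpose]

/-- The orthogonal reflection in the hyperplane perpendicular to a non-isotropic vector `z`. -/
noncomputable def reflectionMatrix (z : Fin n → ℂ) : Matrix (Fin n) (Fin n) ℂ :=
  1 - (2 / (z ⬝ᵥ z)) • Matrix.vecMulVec z z

theorem reflectionMatrix_mulVec (z x : Fin n → ℂ) :
    reflectionMatrix z *ᵥ x = x - (2 * (z ⬝ᵥ x) / (z ⬝ᵥ z)) • z := by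
  ext i
  simp [reflectionMatrix, Matrix.sub_mulVec, Matrix.smul_mulVec, Matrix.vecMulVec_mulVec]
  ring

theorem reflectionMatrix_mulVec_of_dotProduct_eq_zero {z x : Fin n → ℂ} (h : z ⬝ᵥ x = 0) :
    reflectionMatrix z *ᵥ x = x := by
  simp [reflectionMatrix_mulVec, h]

theorem reflectionMatrix_mulVec_self {z : Fin n → ℂ} (hz : z ⬝ᵥ z ≠ 0) :
    reflectionMatrix z *ᵥ z = -z := by
  rw [reflectionMatrix_mulVec, mul_div_assoc, div_self hz]
  ext i
  simp
  ring

theorem reflectionMatrix_mem {z : Fin n → ℂ} (hz : z ⬝ᵥ z ≠ 0) :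
    reflectionMatrix z ∈ Matrix.orthogonalGroup (Fin n) ℂ := by
  rw [Matrix.mem_orthogonalGroup_iff]
  have : (reflectionMatrix z)ᵀ = reflectionMatrix z := by
    simp [reflectionMatrix, Matrix.transpose_vecMulVec]
  rw [this]
  simp only [reflectionMatrix, sub_mul, mul_sub, one_mul, mul_one, Matrix.smul_mul, Matrix.mul_smul,
    Matrix.vecMulVec_mul_vecMulVec]
  ext i j
  simp [Matrix.vecMulVec_apply]
  field_simp
  ring

theorem det_reflectionMatrix {z : Fin n → ℂ} (hz : z ⬝ᵥ z ≠ 0) :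
    (reflectionMatrix z).det = -1 := by
  have e : reflectionMatrix z = 1 + Matrix.replicateCol Unit (-(2 / (z ⬝ᵥ z)) • z) *
      Matrix.replicateRow Unit z := by
    ext i j
    simp [reflectionMatrix, Matrix.mul_apply, Matrix.vecMulVec_apply]
    ring
  rw [e, Matrix.det_one_add_replicateCol_mul_replicateRow, dotProduct_smul, smul_eq_mul]
  field_simp
  ring

theorem dotProduct_mulVec_mulVec {P : Matrix (Fin n) (Fin n) ℂ}
    (hP : P ∈ Matrix.orthogonalGroup (Fin n) ℂ) (x y : Fin n → ℂ) :
    (P *ᵥ x) ⬝ᵥ (P *ᵥ y) = x ⬝ᵥ y := by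
  rw [Matrix.dotProduct_mulVec, Matrix.vecMul_mulVec, (Matrix.mem_orthogonalGroup_iff' _ _).1 hP,
    Matrix.vecMul_one]

/-- Two non-isotropic vectors of equal square are exchanged, up to sign, by the reflection in
their difference or in their sum. -/
theorem exists_orthogonal_mulVec_eq_or_neg {x y : Fin n → ℂ} (hxy : x ⬝ᵥ x = y ⬝ᵥ y)
    (hx : x ⬝ᵥ x ≠ 0) :
    ∃ P ∈ Matrix.orthogonalGroup (Fin n) ℂ, (P *ᵥ x = y ∨ P *ᵥ x = -y) ∧
      ∀ w, x ⬝ᵥ w = 0 → y ⬝ᵥ w = 0 → P *ᵥ w = w := by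
  have hc : y ⬝ᵥ x = x ⬝ᵥ y := dotProduct_comm _ _
  by_cases h : (x - y) ⬝ᵥ (x - y) = 0
  · have h1 : x ⬝ᵥ y = x ⬝ᵥ x := by
      simp only [sub_dotProduct, dotProduct_sub, hc, ← hxy] at h
      linear_combination -h / 2
    have e : (x + y) ⬝ᵥ (x + y) = 4 * (x ⬝ᵥ x) := by
      simp only [add_dotProduct, dotProduct_add, hc, ← hxy, h1]
      ring
    have e' : (x + y) ⬝ᵥ x = 2 * (x ⬝ᵥ x) := by
      simp only [add_dotProduct, hc, h1]
      ring
    have hz : (x + y) ⬝ᵥ (x + y) ≠ 0 := by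
      rw [e]
      simpa using hx
    refine ⟨reflectionMatrix (x + y), reflectionMatrix_mem hz, Or.inr ?_, fun w h1 h2 => ?_⟩
    · have : 2 * ((x + y) ⬝ᵥ x) / ((x + y) ⬝ᵥ (x + y)) = 1 := by
        rw [e, e']
        field_simp
        norm_num
      rw [reflectionMatrix_mulVec, this, one_smul]
      abel
    · exact reflectionMatrix_mulVec_of_dotProduct_eq_zero (by rw [add_dotProduct, h1, h2, add_zero])
  · refine ⟨reflectionMatrix (x - y), reflectionMatrix_mem h, Or.inl ?_, fun w h1 h2 => ?_⟩
    · have : 2 * ((x - y) ⬝ᵥ x) / ((x - y) ⬝ᵥ (x - y)) = 1 := by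
        rw [div_eq_one_iff_eq h]
        simp only [sub_dotProduct, dotProduct_sub, hc, ← hxy]
        ring
      rw [reflectionMatrix_mulVec, this, one_smul]
      abel
    · exact reflectionMatrix_mulVec_of_dotProduct_eq_zero (by rw [sub_dotProduct, h1, h2, sub_zero])

/-- Two isotropic vectors that are not perpendicular are exchanged by the reflection in their
difference. -/
theorem exists_orthogonal_mulVec_eq_of_isotropic_of_dotProduct_ne_zero {x y : Fin n → ℂ}
    (hx : x ⬝ᵥ x = 0) (hy : y ⬝ᵥ y = 0) (hxy : x ⬝ᵥ y ≠ 0) :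
    ∃ P ∈ Matrix.orthogonalGroup (Fin n) ℂ, P *ᵥ x = y ∧
      ∀ w, x ⬝ᵥ w = 0 → y ⬝ᵥ w = 0 → P *ᵥ w = w := by
  have hc : y ⬝ᵥ x = x ⬝ᵥ y := dotProduct_comm _ _
  have e : (x - y) ⬝ᵥ (x - y) = -2 * (x ⬝ᵥ y) := by
    simp only [sub_dotProduct, dotProduct_sub, hc, hx, hy]
    ring
  have h : (x - y) ⬝ᵥ (x - y) ≠ 0 := by
    rw [e]
    simpa using hxy
  refine ⟨reflectionMatrix (x - y), reflectionMatrix_mem h, ?_, fun w h1 h2 => ?_⟩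
  · have : 2 * ((x - y) ⬝ᵥ x) / ((x - y) ⬝ᵥ (x - y)) = 1 := by
      rw [div_eq_one_iff_eq h, e, sub_dotProduct, hc, hx]
      ring
    rw [reflectionMatrix_mulVec, this, one_smul]
    abel
  · exact reflectionMatrix_mulVec_of_dotProduct_eq_zero (by rw [sub_dotProduct, h1, h2, sub_zero])

open scoped ComplexOrder in
theorem star_dotProduct_self_ne_zero {x : Fin n → ℂ} (hx : x ≠ 0) : star x ⬝ᵥ x ≠ 0 :=
  fun h => hx (dotProduct_star_self_eq_zero.1 h)

/-- Nondegeneracy of the complex inner product on the orthogonal complement of a non-isotropic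
vector. -/
theorem exists_dotProduct_ne_zero_of_orthogonal {a x : Fin n → ℂ} (ha : a ⬝ᵥ a ≠ 0)
    (hax : a ⬝ᵥ x = 0) (hx : x ≠ 0) : ∃ d, a ⬝ᵥ d = 0 ∧ x ⬝ᵥ d ≠ 0 := by
  refine ⟨star x - ((a ⬝ᵥ star x) / (a ⬝ᵥ a)) • a, ?_, ?_⟩
  · rw [dotProduct_sub, dotProduct_smul, smul_eq_mul]
    field_simp
    ring
  · rw [dotProduct_sub, dotProduct_smul, dotProduct_comm x a, hax, smul_zero, sub_zero,
      dotProduct_comm]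
    exact star_dotProduct_self_ne_zero hx

/-- Nonzero isotropic vectors in the complement of a non-isotropic `a` are equivalent under the
stabilizer of `a`.  If they are perpendicular, one of them is first moved by a reflection. -/
theorem exists_orthogonal_mulVec_eq_of_isotropic {a x y : Fin n → ℂ} (ha : a ⬝ᵥ a ≠ 0)
    (hax : a ⬝ᵥ x = 0) (hay : a ⬝ᵥ y = 0) (hx : x ⬝ᵥ x = 0) (hy : y ⬝ᵥ y = 0) (hx0 : x ≠ 0)
    (hy0 : y ≠ 0) :
    ∃ P ∈ Matrix.orthogonalGroup (Fin n) ℂ, P *ᵥ x = y ∧ P *ᵥ a = a := by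
  by_cases hxy : x ⬝ᵥ y = 0
  · -- a vector `d` perpendicular to `a`, non-isotropic, and perpendicular to neither `x` nor `y`
    obtain ⟨d, had, hxd, hyd⟩ : ∃ d, a ⬝ᵥ d = 0 ∧ x ⬝ᵥ d ≠ 0 ∧ y ⬝ᵥ d ≠ 0 := by
      obtain ⟨d₁, h1, h1'⟩ := exists_dotProduct_ne_zero_of_orthogonal ha hax hx0
      obtain ⟨d₂, h2, h2'⟩ := exists_dotProduct_ne_zero_of_orthogonal ha hay hy0
      by_cases h3 : y ⬝ᵥ d₁ = 0
      · by_cases h4 : x ⬝ᵥ d₂ = 0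
        · refine ⟨d₁ + d₂, ?_, ?_, ?_⟩
          · rw [dotProduct_add, h1, h2, add_zero]
          · rwa [dotProduct_add, h4, add_zero]
          · rwa [dotProduct_add, h3, zero_add]
        · exact ⟨d₂, h2, h4, h2'⟩
      · exact ⟨d₁, h1, h1', h3⟩
    obtain ⟨d, had, hxd, hyd, hd⟩ :
        ∃ d, a ⬝ᵥ d = 0 ∧ x ⬝ᵥ d ≠ 0 ∧ y ⬝ᵥ d ≠ 0 ∧ d ⬝ᵥ d ≠ 0 := by
      by_cases hd : d ⬝ᵥ d = 0
      · refine ⟨d + x, ?_, ?_, ?_, ?_⟩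
        · rw [dotProduct_add, had, hax, add_zero]
        · rwa [dotProduct_add, hx, add_zero]
        · rwa [dotProduct_add, dotProduct_comm y x, hxy, add_zero]
        · rw [dotProduct_add, add_dotProduct, add_dotProduct, hd, hx, dotProduct_comm d x, zero_add,
            add_zero, ← two_mul]
          simpa using hxd
      · exact ⟨d, had, hxd, hyd, hd⟩
    have hda : d ⬝ᵥ a = 0 := by rw [dotProduct_comm, had]
    have hR := reflectionMatrix_mem hd
    have hRa := reflectionMatrix_mulVec_of_dotProduct_eq_zero hda
    set x' := reflectionMatrix d *ᵥ x with hx'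
    have h1 : x' ⬝ᵥ x' = 0 := by rw [hx', dotProduct_mulVec_mulVec hR, hx]
    have h2 : x' ⬝ᵥ y ≠ 0 := by
      rw [hx', reflectionMatrix_mulVec, sub_dotProduct, hxy, smul_dotProduct, smul_eq_mul, zero_sub,
        neg_ne_zero, dotProduct_comm d x, dotProduct_comm d y]
      exact mul_ne_zero (div_ne_zero (mul_ne_zero two_ne_zero hxd) hd) hyd
    have h3 : x' ⬝ᵥ a = 0 := by
      rw [hx', ← hRa, dotProduct_mulVec_mulVec hR, dotProduct_comm, hax]
    obtain ⟨P, hP, hPx, hPw⟩ :=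
      exists_orthogonal_mulVec_eq_of_isotropic_of_dotProduct_ne_zero h1 hy h2
    refine ⟨P * reflectionMatrix d, mul_mem hP hR, ?_, ?_⟩
    · rw [← Matrix.mulVec_mulVec, ← hx', hPx]
    · rw [← Matrix.mulVec_mulVec, hRa, hPw a h3 (by rw [dotProduct_comm, hay])]
  · obtain ⟨P, hP, hPx, hPw⟩ :=
      exists_orthogonal_mulVec_eq_of_isotropic_of_dotProduct_ne_zero hx hy hxy
    exact ⟨P, hP, hPx, hPw a (by rw [dotProduct_comm, hax]) (by rw [dotProduct_comm, hay])⟩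

/-- Witt's theorem, up to signs, for the pairs consisting of a unit vector and a nonzero vector
perpendicular to it. -/
theorem exists_orthogonal_mulVec_pair {e u a b : Fin n → ℂ} (he : e ⬝ᵥ e = 1) (ha : a ⬝ᵥ a = 1)
    (heu : e ⬝ᵥ u = 0) (hab : a ⬝ᵥ b = 0) (hub : u ⬝ᵥ u = b ⬝ᵥ b) (hu : u ≠ 0) (hb : b ≠ 0) :
    ∃ P ∈ Matrix.orthogonalGroup (Fin n) ℂ,
      (P *ᵥ e = a ∨ P *ᵥ e = -a) ∧ (P *ᵥ u = b ∨ P *ᵥ u = -b) := by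
  have ha0 : a ⬝ᵥ a ≠ 0 := by simp [ha]
  obtain ⟨Q, hQ, hQe, -⟩ := exists_orthogonal_mulVec_eq_or_neg (he.trans ha.symm) (by simp [he])
  have hau : a ⬝ᵥ (Q *ᵥ u) = 0 := by
    have h := dotProduct_mulVec_mulVec hQ e u
    rw [heu] at h
    rcases hQe with h1 | h1 <;> rw [h1] at h
    · exact h
    · simpa using h
  have hQu : (Q *ᵥ u) ⬝ᵥ (Q *ᵥ u) = b ⬝ᵥ b := by rw [dotProduct_mulVec_mulVec hQ, hub]
  have hQu0 : Q *ᵥ u ≠ 0 := by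
    intro h
    apply hu
    have : Qᵀ *ᵥ (Q *ᵥ u) = 0 := by rw [h, Matrix.mulVec_zero]
    rwa [Matrix.mulVec_mulVec, (Matrix.mem_orthogonalGroup_iff' _ _).1 hQ,
      Matrix.one_mulVec] at this
  obtain ⟨P, hP, hPu, hPa⟩ : ∃ P ∈ Matrix.orthogonalGroup (Fin n) ℂ,
      (P *ᵥ (Q *ᵥ u) = b ∨ P *ᵥ (Q *ᵥ u) = -b) ∧ P *ᵥ a = a := by
    by_cases hb0 : b ⬝ᵥ b = 0
    · obtain ⟨P, hP, h1, h2⟩ := exists_orthogonal_mulVec_eq_of_isotropic ha0 hau hab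
        (hQu.trans hb0) hb0 hQu0 hb
      exact ⟨P, hP, Or.inl h1, h2⟩
    · obtain ⟨P, hP, h1, h2⟩ := exists_orthogonal_mulVec_eq_or_neg hQu (by rwa [hQu])
      exact ⟨P, hP, h1, h2 a (by rw [dotProduct_comm, hau]) (by rw [dotProduct_comm, hab])⟩
  refine ⟨P * Q, mul_mem hP hQ, ?_, ?_⟩
  · rw [← Matrix.mulVec_mulVec]
    rcases hQe with h | h <;> rw [h]
    · exact Or.inl hPa
    · right
      rw [Matrix.mulVec_neg, hPa]
  · rwa [← Matrix.mulVec_mulVec]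

end Orbits

/-! ### Positivity along orbits of `SO(n, ℂ)` and their limits -/

section PositivityOnOrbits

variable {n : ℕ} {F : Matrix (Fin n) (Fin n) ℂ → ℝ}

theorem simpleElement_ne_zero_of_orthogonal {a b : Fin n → ℂ} (ha : a ⬝ᵥ a ≠ 0)
    (hab : a ⬝ᵥ b = 0) (hb : b ≠ 0) : simpleElement a b ≠ 0 := by
  intro h
  have h1 := simpleElement_mulVec a b a
  rw [h, Matrix.zero_mulVec, dotProduct_comm b a, hab, zero_smul, sub_zero] at h1
  exact (smul_ne_zero ha hb) h1.symm

/-- The orbit of `X(e, u)` under `SO(n, ℂ)` meets every line spanned by an element `X(a, b)` with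
`a`, `b` of the same kind as `e`, `u`.  Reflecting in `e` changes the sign of `X(e, u)`, which is
why passing from `O(n, ℂ)` to `SO(n, ℂ)` costs nothing. -/
theorem exists_specialOrthogonal_conj_simpleElement {e u a b : Fin n → ℂ} (he : e ⬝ᵥ e ≠ 0)
    (ha : a ⬝ᵥ a ≠ 0) (heu : e ⬝ᵥ u = 0) (hab : a ⬝ᵥ b = 0) (hub : u ⬝ᵥ u = 0 ↔ b ⬝ᵥ b = 0)
    (hu : u ≠ 0) (hb : b ≠ 0) :
    ∃ P ∈ Matrix.specialOrthogonalGroup (Fin n) ℂ, ∃ k : ℂ, k ≠ 0 ∧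
      P * simpleElement e u * P⁻¹ = k • simpleElement a b := by
  obtain ⟨s, hs⟩ := IsAlgClosed.exists_eq_mul_self (e ⬝ᵥ e)
  obtain ⟨t, ht⟩ := IsAlgClosed.exists_eq_mul_self (a ⬝ᵥ a)
  have hs0 : s ≠ 0 := by rintro rfl; exact he (by simpa using hs)
  have ht0 : t ≠ 0 := by rintro rfl; exact ha (by simpa using ht)
  obtain ⟨r, hr0, hr⟩ : ∃ r : ℂ, r ≠ 0 ∧ u ⬝ᵥ u = (r • b) ⬝ᵥ (r • b) := by
    by_cases hb0 : b ⬝ᵥ b = 0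
    · exact ⟨1, one_ne_zero, by simp [hb0, hub.2 hb0]⟩
    · obtain ⟨r, hr⟩ := IsAlgClosed.exists_eq_mul_self ((u ⬝ᵥ u) / (b ⬝ᵥ b))
      refine ⟨r, ?_, ?_⟩
      · rintro rfl
        exact (div_ne_zero (fun h => hb0 (hub.1 h)) hb0) (by simpa using hr)
      · simp only [smul_dotProduct, dotProduct_smul, smul_eq_mul]
        rw [← mul_assoc, ← hr]
        field_simp
  obtain ⟨P, hP, hPe, hPu⟩ := exists_orthogonal_mulVec_pair (e := s⁻¹ • e) (u := u)
    (a := t⁻¹ • a) (b := r • b)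
    (by simp only [smul_dotProduct, dotProduct_smul, smul_eq_mul]; rw [hs]; field_simp)
    (by simp only [smul_dotProduct, dotProduct_smul, smul_eq_mul]; rw [ht]; field_simp)
    (by simp [heu]) (by simp [hab]) hr hu (smul_ne_zero hr0 hb)
  obtain ⟨c, hc0, hc⟩ : ∃ c : ℂ, c ≠ 0 ∧ P *ᵥ e = c • a := by
    have e1 : P *ᵥ e = s • (P *ᵥ (s⁻¹ • e)) := by
      rw [Matrix.mulVec_smul, smul_smul, mul_inv_cancel₀ hs0, one_smul]
    rcases hPe with h | h
    · exact ⟨s * t⁻¹, by simp [hs0, ht0], by rw [e1, h, smul_smul]⟩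
    · exact ⟨-(s * t⁻¹), by simp [hs0, ht0], by rw [e1, h, smul_neg, smul_smul, neg_smul]⟩
  obtain ⟨d, hd0, hd⟩ : ∃ d : ℂ, d ≠ 0 ∧ P *ᵥ u = d • b := by
    rcases hPu with h | h
    · exact ⟨r, hr0, h⟩
    · exact ⟨-r, by simpa using hr0, by rw [h, neg_smul]⟩
  obtain ⟨Q, hQ, hQd, c, hc0, hc, hd⟩ : ∃ Q ∈ Matrix.orthogonalGroup (Fin n) ℂ, Q.det = 1 ∧
      ∃ c : ℂ, c ≠ 0 ∧ Q *ᵥ e = c • a ∧ Q *ᵥ u = d • b := by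
    have hdet : P.det = 1 ∨ P.det = -1 := by
      have := congrArg Matrix.det ((Matrix.mem_orthogonalGroup_iff _ _).1 hP)
      rw [Matrix.det_mul, Matrix.det_transpose, Matrix.det_one] at this
      exact mul_self_eq_one_iff.1 this
    rcases hdet with h | h
    · exact ⟨P, hP, h, c, hc0, hc, hd⟩
    · refine ⟨P * reflectionMatrix e, mul_mem hP (reflectionMatrix_mem he), ?_, -c,
        neg_ne_zero.2 hc0, ?_, ?_⟩
      · rw [Matrix.det_mul, h, det_reflectionMatrix he]
        norm_num
      · rw [← Matrix.mulVec_mulVec, reflectionMatrix_mulVec_self he, Matrix.mulVec_neg, hc,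
          neg_smul]
      · rw [← Matrix.mulVec_mulVec, reflectionMatrix_mulVec_of_dotProduct_eq_zero heu, hd]
  refine ⟨Q, Matrix.mem_specialOrthogonalGroup_iff.2 ⟨hQ, hQd⟩, c * d, mul_ne_zero hc0 hd0, ?_⟩
  rw [Matrix.inv_eq_right_inv ((Matrix.mem_orthogonalGroup_iff _ _).1 hQ),
    mul_simpleElement_mul_transpose, hc, hd, simpleElement_smul_smul]

/-- Only homogeneity of `F` matters here; `F` will be `X ↦ ⟨R(X), X⟩`. -/
theorem pos_simpleElement_of_isAdInvariant
    (hF : ∀ (c : ℂ) X, F (c • X) = ‖c‖ ^ 2 * F X) {S : Set (Matrix (Fin n) (Fin n) ℂ)}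
    (hS : IsAdInvariant S) (hpos : ∀ X ∈ S, X ≠ 0 → 0 < F X) {e u a b : Fin n → ℂ}
    (he : e ⬝ᵥ e ≠ 0) (heu : e ⬝ᵥ u = 0) (hu : u ≠ 0) (heS : simpleElement e u ∈ S)
    (ha : a ⬝ᵥ a ≠ 0) (hab : a ⬝ᵥ b = 0) (hb : b ≠ 0) (hub : u ⬝ᵥ u = 0 ↔ b ⬝ᵥ b = 0) :
    0 < F (simpleElement a b) := by
  obtain ⟨P, hP, k, hk, h⟩ :=
    exists_specialOrthogonal_conj_simpleElement he ha heu hab hub hu hb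
  have h1 := hpos _ (hS P hP _ heS)
    (by rw [h]; exact smul_ne_zero hk (simpleElement_ne_zero_of_orthogonal ha hab hb))
  rw [h, hF] at h1
  exact pos_of_mul_pos_right h1 (by positivity)

/-- If `v` is isotropic and `d` is not perpendicular to it, then `v + t d` is non-isotropic for
small `t ≠ 0`, so a nonnegative continuous function of such vectors is nonnegative at `v`. -/
theorem nonneg_simpleElement_of_perturbation (hF : Continuous F) {v w d : Fin n → ℂ}
    (hv : v ⬝ᵥ v = 0) (hvd : v ⬝ᵥ d ≠ 0)
    (h : ∀ t : ℂ, (v + t • d) ⬝ᵥ (v + t • d) ≠ 0 → 0 ≤ F (simpleElement (v + t • d) w)) :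
    0 ≤ F (simpleElement v w) := by
  have hc : Continuous fun t : ℂ => F (simpleElement (v + t • d) w) := by
    apply hF.comp
    unfold simpleElement
    fun_prop
  have h1 : ∀ᶠ t in nhdsWithin (0 : ℂ) {0}ᶜ, 2 * (v ⬝ᵥ d) + t * (d ⬝ᵥ d) ≠ 0 := by
    have hc' : Continuous fun t : ℂ => 2 * (v ⬝ᵥ d) + t * (d ⬝ᵥ d) := by fun_prop
    exact (hc'.continuousAt.eventually_ne (by simpa using hvd)).filter_mono nhdsWithin_le_nhds
  have h2 : ∀ᶠ t in nhdsWithin (0 : ℂ) {0}ᶜ, 0 ≤ F (simpleElement (v + t • d) w) := by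
    filter_upwards [h1, self_mem_nhdsWithin] with t ht ht0
    apply h
    have : (v + t • d) ⬝ᵥ (v + t • d) = t * (2 * (v ⬝ᵥ d) + t * (d ⬝ᵥ d)) := by
      simp only [add_dotProduct, dotProduct_add, smul_dotProduct, dotProduct_smul, smul_eq_mul, hv,
        dotProduct_comm d v]
      ring
    rw [this]
    exact mul_ne_zero ht0 ht
  have h3 := (hc.tendsto 0).mono_left (nhdsWithin_le_nhds (s := {0}ᶜ))
  simpa using ge_of_tendsto h3 h2

/-- The Hermitian form is definite on skew-symmetric matrices. -/
theorem soInner_self_eq_zero {X : Matrix (Fin n) (Fin n) ℂ} (hX : Xᵀ = -X) (h : soInner X X = 0) :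
    X = 0 := by
  open scoped ComplexOrder in
  have e : X.map (starRingEnd ℂ) = -Xᴴ := by
    have : X.map (starRingEnd ℂ) = (Xᵀ)ᴴ := by
      ext i j
      simp
    rw [this, hX, Matrix.conjTranspose_neg]
  rw [soInner, e, mul_neg, Matrix.trace_neg] at h
  have h1 : (X * Xᴴ).trace = 0 := by linear_combination 2 * h
  exact Matrix.trace_mul_conjTranspose_self_eq_zero_iff.1 h1

theorem simpleElement_transpose (u v : Fin n → ℂ) :
    (simpleElement u v)ᵀ = -simpleElement u v := by
  simp [simpleElement, Matrix.transpose_vecMulVec]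

/-- Positivity on an invariant set containing some `X(e, u)` with `e` non-isotropic and `u`
perpendicular to `e` passes, in the limit, to all `X(v, w)` with `v` isotropic and `w`
perpendicular to `v`. -/
theorem nonneg_simpleElement_of_isAdInvariant (hFc : Continuous F)
    (hF : ∀ (c : ℂ) X, F (c • X) = ‖c‖ ^ 2 * F X) {S : Set (Matrix (Fin n) (Fin n) ℂ)}
    (hS : IsAdInvariant S) (hpos : ∀ X ∈ S, X ≠ 0 → 0 < F X) {e u v w : Fin n → ℂ}
    (he : e ⬝ᵥ e ≠ 0) (heu : e ⬝ᵥ u = 0) (hu : u ≠ 0) (heS : simpleElement e u ∈ S)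
    (hv : v ⬝ᵥ v = 0) (hvw : v ⬝ᵥ w = 0) : 0 ≤ F (simpleElement v w) := by
  have hF0 : F 0 = 0 := by simpa using hF 0 0
  have hneg : ∀ X, F (-X) = F X := fun X => by simpa using hF (-1) X
  have hswap : ∀ a b, F (simpleElement a b) = F (simpleElement b a) := fun a b => by
    rw [simpleElement_swap, hneg]
  -- the case of a non-isotropic `w`
  have key : ∀ v w : Fin n → ℂ, v ⬝ᵥ v = 0 → v ⬝ᵥ w = 0 → w ⬝ᵥ w ≠ 0 →
      0 ≤ F (simpleElement v w) := by
    intro v w hv hvw hw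
    have hwv : w ⬝ᵥ v = 0 := by rw [dotProduct_comm, hvw]
    by_cases hv0 : v = 0
    · simp [hv0, simpleElement, hF0]
    by_cases hu0 : u ⬝ᵥ u = 0
    · rw [hswap]
      exact (pos_simpleElement_of_isAdInvariant hF hS hpos he heu hu heS hw hwv hv0
        (by simp [hu0, hv])).le
    · obtain ⟨d, hwd, hvd⟩ := exists_dotProduct_ne_zero_of_orthogonal hw hwv hv0
      refine nonneg_simpleElement_of_perturbation hFc hv hvd fun t ht => ?_
      have hperp : (v + t • d) ⬝ᵥ w = 0 := by
        rw [add_dotProduct, smul_dotProduct, hvw, dotProduct_comm, hwd, smul_zero, add_zero]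
      exact (pos_simpleElement_of_isAdInvariant hF hS hpos he heu hu heS ht hperp
        (by rintro rfl; simp at hw) (by simp [hu0, hw])).le
  by_cases hw : w ⬝ᵥ w = 0
  · by_cases hX : simpleElement v w = 0
    · rw [hX, hF0]
    · -- `w` is perturbed by a vector perpendicular to `v` and not perpendicular to `w`
      -- the pairing of `w` with the vector chosen below is `⟨X(v, w), X(v, w)⟩ ≠ 0`
      have hgram := fun h => hX (soInner_self_eq_zero (simpleElement_transpose v w) h)
      rw [soInner_simpleElement] at hgram
      rw [hswap]
      refine nonneg_simpleElement_of_perturbation hFc hw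
        (d := (v ⬝ᵥ star v) • star w - (v ⬝ᵥ star w) • star v) ?_ fun t ht => ?_
      · rw [dotProduct_sub, dotProduct_smul, dotProduct_smul, smul_eq_mul, smul_eq_mul]
        exact hgram
      · rw [hswap]
        refine key _ _ hv ?_ ht
        simp only [dotProduct_add, dotProduct_smul, dotProduct_sub, hvw, smul_eq_mul]
        ring
  · exact key v w hv hvw hw

end PositivityOnOrbits

/-! ### Isotropic curvature of `M × ℝ` -/

section IsotropicCurvature

/-- A skew-symmetric matrix `X` of rank two with `X² = 0` is `X(v, w)` with `v`, `w` spanning a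
totally isotropic plane: two columns of `X` span its range. -/
theorem exists_eq_simpleElement_of_mem_isotropicSet {m : ℕ} {X : Matrix (Fin m) (Fin m) ℂ}
    (hX : X ∈ isotropicSet m) : ∃ v w : Fin m → ℂ,
      X = simpleElement v w ∧ v ⬝ᵥ v = 0 ∧ v ⬝ᵥ w = 0 ∧ w ⬝ᵥ w = 0 := by
  obtain ⟨hso, hrank, hsq⟩ := hX
  have hT : Xᵀ = -X := (LieAlgebra.Orthogonal.mem_so _ _ _).1 hso
  have hskew : ∀ i j, X j i = -X i j := fun i j => congrFun (congrFun hT i) j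
  have hdiag : ∀ i, X i i = 0 := fun i => by
    have := hskew i i
    linear_combination this / 2
  obtain ⟨i, j, hij⟩ : ∃ i j, X i j ≠ 0 := by
    by_contra! h
    have : X = 0 := by ext i j; exact h i j
    simp [this] at hrank
  have hji : X j i ≠ 0 := by rw [hskew i j]; simpa using hij
  have hind : LinearIndependent ℂ ![X.col i, X.col j] := by
    rw [LinearIndependent.pair_iff]
    intro s t hst
    have h1 := congrFun hst i
    have h2 := congrFun hst j
    simp [Matrix.col_apply, hdiag, hij, hji] at h1 h2
    exact ⟨h2, h1⟩
  have hspan : Submodule.span ℂ (Set.range ![X.col i, X.col j]) =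
      LinearMap.range X.mulVecLin := by
    apply Submodule.eq_of_le_of_finrank_eq
    · rw [Submodule.span_le, Matrix.range_mulVecLin]
      rintro _ ⟨k, rfl⟩
      apply Submodule.subset_span
      fin_cases k
      · exact ⟨i, rfl⟩
      · exact ⟨j, rfl⟩
    · rw [finrank_span_eq_card hind, Fintype.card_fin]
      exact hrank.symm
  have hcol : ∀ k l, X l k = (X i j)⁻¹ * (X l i * X k j - X l j * X k i) := by
    intro k l
    have hk : X.col k ∈ Submodule.span ℂ (Set.range ![X.col i, X.col j]) := by
      rw [hspan, Matrix.range_mulVecLin]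
      exact Submodule.subset_span ⟨k, rfl⟩
    rw [Matrix.range_cons, Matrix.range_cons, Matrix.range_empty, Set.union_empty,
      Set.singleton_union, Submodule.mem_span_pair] at hk
    obtain ⟨s, t, hst⟩ := hk
    have h0 := congrFun hst l
    have h1 := congrFun hst i
    have h2 := congrFun hst j
    simp only [Pi.add_apply, Pi.smul_apply, Matrix.col_apply, smul_eq_mul, hdiag, mul_zero,
      zero_add, add_zero] at h0 h1 h2
    rw [hskew i k, hskew j k, ← h0, ← h1, ← h2, hskew i j]
    field_simp
    ring
  have horth : ∀ k l, X.col k ⬝ᵥ X.col l = 0 := by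
    intro k l
    have h1 : (Xᵀ * X) k l = 0 := by rw [hT, neg_mul, hsq, neg_zero, Matrix.zero_apply]
    exact h1
  refine ⟨(X i j)⁻¹ • X.col j, X.col i, ?_, ?_, ?_, horth i i⟩
  · ext l k
    rw [hcol k l]
    simp [simpleElement, Matrix.vecMulVec_apply]
    ring
  · simp [horth]
  · simp [horth]

variable {E : Type*} [NormedAddCommGroup E] [NormedSpace ℝ E]
  {H : Type*} [TopologicalSpace H] {I : ModelWithCorners ℝ E H}
  {M : Type*} [TopologicalSpace M] [ChartedSpace H M] {n : ℕ}

theorem continuous_re_soInner_curvatureOperator {g : MetricField I M} {p : M}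
    (L : TangentIsometry g p n) :
    Continuous fun X => (soInner (curvatureOperator L X) X).re := by
  have h1 : ∀ B : Matrix (Fin n) (Fin n) ℂ, Continuous fun X => soInner X B := by
    intro B
    unfold soInner
    fun_prop
  have h2 : Continuous (curvatureOperator L) := by
    unfold curvatureOperator
    refine continuous_finsetSum _ fun i _ => continuous_finsetSum _ fun j _ =>
      continuous_finsetSum _ fun k _ => continuous_finsetSum _ fun l _ => ?_
    split_ifs
    · exact ((h1 _).mul continuous_const).smul continuous_const
    · exact continuous_const
  have h3 : Continuous fun X : Matrix (Fin n) (Fin n) ℂ => X.map (starRingEnd ℂ) :=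
    continuous_id.matrix_map Complex.continuous_conj
  unfold soInner
  exact Complex.continuous_re.comp (continuous_const.mul (h2.matrix_mul h3).matrix_trace)

theorem re_soInner_curvatureOperator_smul {g : MetricField I M} {p : M}
    (L : TangentIsometry g p n) (c : ℂ) (X : Matrix (Fin n) (Fin n) ℂ) :
    (soInner (curvatureOperator L (c • X)) (c • X)).re =
      ‖c‖ ^ 2 * (soInner (curvatureOperator L X) X).re := by
  have h1 : curvatureOperator L (c • X) = c • curvatureOperator L X := by
    simp only [curvatureOperator, Finset.smul_sum]
    refine Finset.sum_congr rfl fun i _ => Finset.sum_congr rfl fun j _ =>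
      Finset.sum_congr rfl fun k _ => Finset.sum_congr rfl fun l _ => ?_
    split_ifs
    · rw [soInner_smul_left, smul_smul, mul_assoc]
    · rw [smul_zero]
  have h2 : ∀ A B : Matrix (Fin n) (Fin n) ℂ,
      soInner A (c • B) = starRingEnd ℂ c * soInner A B := by
    intro A B
    have : (c • B).map (starRingEnd ℂ) = starRingEnd ℂ c • B.map (starRingEnd ℂ) := by
      ext i j
      simp
    rw [soInner, soInner, this, Matrix.mul_smul, Matrix.trace_smul, smul_eq_mul]
    ring
  rw [h1, soInner_smul_left, h2, ← mul_assoc, Complex.mul_conj, Complex.re_ofReal_mul,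
    Complex.normSq_eq_norm_sq]

/-- The vector of `ℂⁿ` with real part `x` and imaginary part `y`. -/
noncomputable def complexVec (x y : Fin n → ℝ) : Fin n → ℂ := fun i => x i + y i * Complex.I

theorem complexVec_dotProduct (x y x' y' : Fin n → ℝ) :
    complexVec x y ⬝ᵥ complexVec x' y' =
      ((x ⬝ᵥ x' - y ⬝ᵥ y' : ℝ) : ℂ) + ((x ⬝ᵥ y' + y ⬝ᵥ x' : ℝ) : ℂ) * Complex.I := by
  simp only [complexVec, dotProduct]
  push_cast
  simp only [← Finset.sum_sub_distrib, ← Finset.sum_add_distrib, Finset.sum_mul]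
  refine Finset.sum_congr rfl fun i _ => ?_
  linear_combination (y i : ℂ) * y' i * Complex.I_mul_I

theorem complexVec_re_im (v : Fin n → ℂ) : complexVec (fun i => (v i).re) (fun i => (v i).im) = v :=
  funext fun i => Complex.re_add_im (v i)

theorem re_soInner_curvatureOperator_complexVec {g : MetricField I M} {p : M}
    (L : TangentIsometry g p n) (hT : IsCurvatureForm (riemannTensor g p))
    (a b c d : TangentSpace I p) :
    (soInner (curvatureOperator L
        (simpleElement (complexVec (L.toEquiv a) (L.toEquiv b))
          (complexVec (L.toEquiv c) (L.toEquiv d))))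
      (simpleElement (complexVec (L.toEquiv a) (L.toEquiv b))
        (complexVec (L.toEquiv c) (L.toEquiv d)))).re =
      complexSectional (riemannTensor g p) a b c d := by
  have h1 : ∀ x y : Fin n → ℝ, (fun i => (complexVec x y i).re) = x := fun x y => by
    ext i; simp [complexVec]
  have h2 : ∀ x y : Fin n → ℝ, (fun i => (complexVec x y i).im) = y := fun x y => by
    ext i; simp [complexVec]
  rw [re_soInner_curvatureOperator L hT]
  simp only [h1, h2, LinearEquiv.symm_apply_apply]

/-- Nonnegativity of the curvature operator of `M` on all `X(v, w)` with `v` isotropic and `w`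
perpendicular to `v` gives nonnegative isotropic curvature of `M × ℝ`: every totally isotropic plane
contains a vector `v` tangent to `M`, and the curvature of `M × ℝ` only sees the projection to `M`
of a second vector `w`. -/
theorem hasNonnegIsotropicCurvature_productMetric_lineMetric [FiniteDimensional ℝ E]
    [I.Boundaryless] [IsManifold I ∞ M] {g : MetricField I M}
    (hg : ∀ p, IsMetricOn (chartMetric g p) (extChartAt I p).target)
    (h : ∀ p, ∃ L : TangentIsometry g p n, ∀ v w : Fin n → ℂ, v ⬝ᵥ v = 0 → v ⬝ᵥ w = 0 →
      0 ≤ (soInner (curvatureOperator L (simpleElement v w)) (simpleElement v w)).re) :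
    HasNonnegIsotropicCurvature (n + 1) (productMetric g lineMetric) := by
  intro p L' X hX
  obtain ⟨L, hL⟩ := h p.1
  have hT := isCurvatureForm_riemannTensor (hg p.1)
  have hT' : IsCurvatureForm (riemannTensor (productMetric g lineMetric) p) :=
    isCurvatureForm_riemannTensor
      ((hg p.1).chartMetric_prod (isMetricOn_chartMetric_lineMetric p.2))
  obtain ⟨v, w, rfl, hvv, hvw, hww⟩ := exists_eq_simpleElement_of_mem_isotropicSet hX
  -- the components of tangent vectors along `M` and along `ℝ`
  let prM : TangentSpace (I.prod 𝓘(ℝ, ℝ)) p →ₗ[ℝ] TangentSpace I p.1 := by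
    exact LinearMap.fst ℝ E ℝ
  let prR : TangentSpace (I.prod 𝓘(ℝ, ℝ)) p →ₗ[ℝ] ℝ := by
    exact LinearMap.snd ℝ E ℝ
  -- the case of a vector `v` without component along `ℝ`
  have key : ∀ v w : Fin (n + 1) → ℂ, v ⬝ᵥ v = 0 → v ⬝ᵥ w = 0 →
      prR (L'.toEquiv.symm fun i => (v i).re) = 0 → prR (L'.toEquiv.symm fun i => (v i).im) = 0 →
      0 ≤ (soInner (curvatureOperator L' (simpleElement v w)) (simpleElement v w)).re := by
    intro v w hvv hvw h1 h2
    rw [re_soInner_curvatureOperator L' hT']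
    obtain ⟨a, ha⟩ : ∃ a, a = L'.toEquiv.symm fun i => (v i).re := ⟨_, rfl⟩
    obtain ⟨b, hb⟩ : ∃ b, b = L'.toEquiv.symm fun i => (v i).im := ⟨_, rfl⟩
    obtain ⟨c, hc⟩ : ∃ c, c = L'.toEquiv.symm fun i => (w i).re := ⟨_, rfl⟩
    obtain ⟨d, hd⟩ : ∃ d, d = L'.toEquiv.symm fun i => (w i).im := ⟨_, rfl⟩
    rw [← ha] at h1
    rw [← hb] at h2
    rw [← ha, ← hb, ← hc, ← hd]
    have hv : complexVec (L'.toEquiv a) (L'.toEquiv b) = v := by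
      rw [ha, hb, LinearEquiv.apply_symm_apply, LinearEquiv.apply_symm_apply, complexVec_re_im]
    have hw : complexVec (L'.toEquiv c) (L'.toEquiv d) = w := by
      rw [hc, hd, LinearEquiv.apply_symm_apply, LinearEquiv.apply_symm_apply, complexVec_re_im]
    have e : complexSectional (riemannTensor (productMetric g lineMetric) p) a b c d =
        complexSectional (riemannTensor g p.1) (prM a) (prM b) (prM c) (prM d) := by
      simp only [complexSectional, riemannTensor_productMetric_lineMetric (hg p.1)]
      rfl
    have hiso : ∀ x y : TangentSpace (I.prod 𝓘(ℝ, ℝ)) p, prR x = 0 →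
        L'.toEquiv x ⬝ᵥ L'.toEquiv y = L.toEquiv (prM x) ⬝ᵥ L.toEquiv (prM y) := by
      intro x y hx
      rw [L'.isometry, L.isometry]
      change g p.1 (prM x) (prM y) + prR x * prR y = _
      rw [hx, zero_mul, add_zero]
    rw [e, ← re_soInner_curvatureOperator_complexVec L hT]
    apply hL
    · rw [complexVec_dotProduct, ← hiso _ _ h1, ← hiso _ _ h2, ← hiso _ _ h1, ← hiso _ _ h2,
        ← complexVec_dotProduct, hv, hvv]
    · rw [complexVec_dotProduct, ← hiso _ _ h1, ← hiso _ _ h2, ← hiso _ _ h1, ← hiso _ _ h2,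
        ← complexVec_dotProduct, hv, hw, hvw]
  -- the component along `ℝ`, as a complex linear functional
  let f : (Fin (n + 1) → ℝ) →ₗ[ℝ] ℝ :=
    prR ∘ₗ L'.toEquiv.symm.toLinearMap
  by_cases hf : f (fun i => (v i).re) = 0 ∧ f (fun i => (v i).im) = 0
  · exact key v w hvv hvw hf.1 hf.2
  · obtain ⟨z, hz⟩ : ∃ z : ℂ, z = f (fun i => (v i).re) + f (fun i => (v i).im) * Complex.I :=
      ⟨_, rfl⟩
    have hz0 : z ≠ 0 := by
      rintro rfl
      apply hf
      have h1 := congrArg Complex.re hz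
      have h2 := congrArg Complex.im hz
      simp at h1 h2
      exact ⟨h1.symm, h2.symm⟩
    -- `w - t v` has no component along `ℝ`
    obtain ⟨t, ht⟩ : ∃ t : ℂ,
        t * z = f (fun i => (w i).re) + f (fun i => (w i).im) * Complex.I :=
      ⟨_, div_mul_cancel₀ _ hz0⟩
    have hre : f (fun i => ((w - t • v) i).re) = 0 := by
      have e1 : (fun i => ((w - t • v) i).re) =
          (fun i => (w i).re) - t.re • (fun i => (v i).re) + t.im • fun i => (v i).im := by
        ext i
        simp
        ring
      have h1 := congrArg Complex.re ht
      rw [hz] at h1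
      simp at h1
      rw [e1, map_add, map_sub, map_smul, map_smul, smul_eq_mul, smul_eq_mul]
      linarith
    have him : f (fun i => ((w - t • v) i).im) = 0 := by
      have e1 : (fun i => ((w - t • v) i).im) =
          (fun i => (w i).im) - t.re • (fun i => (v i).im) - t.im • fun i => (v i).re := by
        ext i
        simp
        ring
      have h1 := congrArg Complex.im ht
      rw [hz] at h1
      simp at h1
      rw [e1, map_sub, map_sub, map_smul, map_smul, smul_eq_mul, smul_eq_mul]
      linarith
    have hwv : w ⬝ᵥ v = 0 := by rw [dotProduct_comm, hvw]
    have e : simpleElement v w = (-1 : ℂ) • simpleElement (w - t • v) v := by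
      ext i j
      simp [simpleElement, Matrix.vecMulVec_apply]
      ring
    rw [e, re_soInner_curvatureOperator_smul]
    refine mul_nonneg (by positivity) (key _ _ ?_ ?_ hre him)
    · simp [sub_dotProduct, dotProduct_sub, hww, hvv, hvw, hwv]
    · simp [sub_dotProduct, hvv, hwv]

end IsotropicCurvature

/-! ### Irreducibility -/

section Irreducibility

/-- Two vectors of equal length spanning a plane: `b + i c` is then isotropic. -/
theorem exists_orthogonal_pair_of_two_le_finrank {V : Type*} [AddCommGroup V] [Module ℝ V]
    (hV : 2 ≤ Module.finrank ℝ V) (B : V →ₗ[ℝ] V →ₗ[ℝ] ℝ) (hB : ∀ a, a ≠ 0 → 0 < B a a) :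
    ∃ b c, b ≠ 0 ∧ B b b = B c c ∧ B b c = 0 := by
  have : Nontrivial V := Module.nontrivial_of_finrank_pos (R := ℝ) (by omega)
  obtain ⟨b, hb⟩ := exists_ne (0 : V)
  obtain ⟨y, hy⟩ : ∃ y, ∀ r : ℝ, r • b ≠ y := by
    by_contra! h
    have := finrank_le_one b h
    omega
  have hbb := hB b hb
  set z := y - (B b y / B b b) • b with hz
  have hz0 : z ≠ 0 := fun h => hy _ (sub_eq_zero.1 h).symm
  have hzz := hB z hz0
  refine ⟨b, Real.sqrt (B b b / B z z) • z, hb, ?_, ?_⟩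
  · simp only [map_smul, LinearMap.smul_apply, smul_eq_mul]
    rw [← mul_assoc, Real.mul_self_sqrt (by positivity)]
    field_simp
  · have hbz : B b z = 0 := by
      rw [hz, map_sub, map_smul, smul_eq_mul, div_mul_cancel₀ _ hbb.ne', sub_self]
    rw [map_smul, hbz, smul_zero]

variable {E : Type*} [NormedAddCommGroup E] [NormedSpace ℝ E]
  {H : Type*} [TopologicalSpace H] {I : ModelWithCorners ℝ E H}
  {M : Type*} [TopologicalSpace M] [ChartedSpace H M] {n : ℕ}

/-- Planes mixing two factors of a Riemannian product are flat.  This contradicts the positivity of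
the curvature operator on all `X(v, w)` of the given kind, with `v = a` and `w = b + i c`. -/
theorem false_of_mixed_curvature_eq_zero {g : MetricField I M} {p : M}
    (L : TangentIsometry g p n) (hT : IsCurvatureForm (riemannTensor g p)) {q : ℂ}
    (hpos : ∀ v w : Fin n → ℂ, v ⬝ᵥ v ≠ 0 → v ⬝ᵥ w = 0 → w ≠ 0 → (q = 0 ↔ w ⬝ᵥ w = 0) →
      0 < (soInner (curvatureOperator L (simpleElement v w)) (simpleElement v w)).re)
    {a b c : TangentSpace I p} (ha : g p a a ≠ 0) (hb : b ≠ 0) (hab : g p a b = 0)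
    (hac : g p a c = 0) (hbc : g p b c = 0) (hcb : g p c b = 0)
    (hq : q = 0 ↔ g p b b = g p c c)
    (hTab : ∀ x y, riemannTensor g p a b x y = 0) (hTac : ∀ x y, riemannTensor g p a c x y = 0) :
    False := by
  have h := hpos (complexVec (L.toEquiv a) (L.toEquiv 0)) (complexVec (L.toEquiv b) (L.toEquiv c))
    ?_ ?_ ?_ ?_
  · rw [re_soInner_curvatureOperator_complexVec L hT] at h
    have hT0 : ∀ x y z, riemannTensor g p 0 x y z = 0 := fun x y z =>
      (hT.linear_first x y z).map_zero
    simp only [complexSectional, hTab, hTac, hT0] at h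
    norm_num at h
  · rw [complexVec_dotProduct]
    simp only [L.isometry, map_zero]
    simpa using ha
  · rw [complexVec_dotProduct]
    simp only [L.isometry, map_zero, hab, hac]
    simp
  · intro h0
    apply hb
    have : L.toEquiv b = 0 := by
      ext i
      have := congrArg Complex.re (congrFun h0 i)
      simpa [complexVec] using this
    exact (LinearEquiv.map_eq_zero_iff _).1 this
  · rw [complexVec_dotProduct, hq]
    simp only [L.isometry, hbc, hcb]
    rw [add_zero, Complex.ofReal_zero, zero_mul, add_zero, Complex.ofReal_eq_zero, sub_eq_zero]

/-- The tangent space at a point cannot split into two nontrivial orthogonal summands such that the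
curvature of all mixed planes vanishes.  A vector `w` of the required kind is found in one of the
summands, except when both are lines; but then the curvature vanishes altogether. -/
theorem false_of_orthogonal_splitting {g : MetricField I M} {p : M}
    (hsymm : ∀ a b, g p a b = g p b a) (hgpos : ∀ a, a ≠ 0 → 0 < g p a a)
    (L : TangentIsometry g p n) (hT : IsCurvatureForm (riemannTensor g p)) {e u : Fin n → ℂ}
    (he : e ⬝ᵥ e ≠ 0) (heu : e ⬝ᵥ u = 0) (hu : u ≠ 0)
    (hpos : ∀ v w : Fin n → ℂ, v ⬝ᵥ v ≠ 0 → v ⬝ᵥ w = 0 → w ≠ 0 → (u ⬝ᵥ u = 0 ↔ w ⬝ᵥ w = 0) →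
      0 < (soInner (curvatureOperator L (simpleElement v w)) (simpleElement v w)).re)
    {V₁ V₂ : Type*} [AddCommGroup V₁] [Module ℝ V₁] [AddCommGroup V₂] [Module ℝ V₂]
    (hV₁ : 0 < Module.finrank ℝ V₁) (hV₂ : 0 < Module.finrank ℝ V₂)
    (i₁ : V₁ →ₗ[ℝ] TangentSpace I p) (i₂ : V₂ →ₗ[ℝ] TangentSpace I p)
    (hi₁ : Function.Injective i₁) (hi₂ : Function.Injective i₂)
    (hspan : ∀ y, ∃ a b, y = i₁ a + i₂ b) (horth : ∀ a b, g p (i₁ a) (i₂ b) = 0)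
    (hmixed : ∀ a b y z, riemannTensor g p (i₁ a) (i₂ b) y z = 0) : False := by
  have horth' : ∀ a b, g p (i₂ a) (i₁ b) = 0 := fun a b => by rw [hsymm, horth]
  have hmixed' : ∀ a b y z, riemannTensor g p (i₂ a) (i₁ b) y z = 0 := fun a b y z => by
    rw [hT.skew_left, hmixed, neg_zero]
  have hn₁ : ∀ a, a ≠ 0 → i₁ a ≠ 0 := fun a => (map_ne_zero_iff i₁ hi₁).2
  have hn₂ : ∀ a, a ≠ 0 → i₂ a ≠ 0 := fun a => (map_ne_zero_iff i₂ hi₂).2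
  have : Nontrivial V₁ := Module.nontrivial_of_finrank_pos hV₁
  have : Nontrivial V₂ := Module.nontrivial_of_finrank_pos hV₂
  obtain ⟨a₁, ha₁⟩ := exists_ne (0 : V₁)
  obtain ⟨a₂, ha₂⟩ := exists_ne (0 : V₂)
  have pa₁ := (hgpos _ (hn₁ _ ha₁)).ne'
  have pa₂ := (hgpos _ (hn₂ _ ha₂)).ne'
  let B : TangentSpace I p →ₗ[ℝ] TangentSpace I p →ₗ[ℝ] ℝ :=
    ContinuousLinearMap.toLinearMap₁₂ (g p)
  by_cases hq : u ⬝ᵥ u = 0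
  · by_cases hl : 2 ≤ Module.finrank ℝ V₂
    · obtain ⟨b, c, hb, hbc, hbc'⟩ := exists_orthogonal_pair_of_two_le_finrank hl
        (B.compl₁₂ i₂ i₂) fun a ha => hgpos _ (hn₂ a ha)
      exact false_of_mixed_curvature_eq_zero L hT hpos pa₁ (hn₂ b hb) (horth a₁ b) (horth a₁ c)
        hbc' ((hsymm _ _).trans hbc') (iff_of_true hq hbc) (hmixed a₁ b) (hmixed a₁ c)
    by_cases hk : 2 ≤ Module.finrank ℝ V₁
    · obtain ⟨b, c, hb, hbc, hbc'⟩ := exists_orthogonal_pair_of_two_le_finrank hk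
        (B.compl₁₂ i₁ i₁) fun a ha => hgpos _ (hn₁ a ha)
      exact false_of_mixed_curvature_eq_zero L hT hpos pa₂ (hn₁ b hb) (horth' a₂ b) (horth' a₂ c)
        hbc' ((hsymm _ _).trans hbc') (iff_of_true hq hbc) (hmixed' a₂ b) (hmixed' a₂ c)
    -- two lines: the only plane is a mixed one
    have hline₁ : ∀ a, ∃ r : ℝ, r • a₁ = a :=
      (finrank_eq_one_iff_of_nonzero' a₁ ha₁).1 (by omega)
    have hline₂ : ∀ a, ∃ r : ℝ, r • a₂ = a :=
      (finrank_eq_one_iff_of_nonzero' a₂ ha₂).1 (by omega)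
    have hflat : ∀ a b c d, riemannTensor g p a b c d = 0 := by
      intro a b c d
      obtain ⟨x₁, x₂, rfl⟩ := hspan a
      obtain ⟨y₁, y₂, rfl⟩ := hspan b
      obtain ⟨r, rfl⟩ := hline₁ x₁
      obtain ⟨r', rfl⟩ := hline₁ y₁
      obtain ⟨s, rfl⟩ := hline₂ x₂
      obtain ⟨s', rfl⟩ := hline₂ y₂
      rw [(hT.linear_first _ c d).map_add (i₁ (r • a₁)), (hT.linear_second _ c d).map_add (i₁ _),
        (hT.linear_second _ c d).map_add (i₁ _), hmixed, hmixed', map_smul, map_smul, map_smul,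
        map_smul, (hT.linear_first _ c d).map_smul r, (hT.linear_first _ c d).map_smul s,
        (hT.linear_second _ c d).map_smul r', (hT.linear_second _ c d).map_smul s',
        hT.apply_self_left, hT.apply_self_left]
      simp
    have h := hpos e u he heu hu Iff.rfl
    rw [re_soInner_curvatureOperator L hT] at h
    simp [complexSectional, hflat] at h
  · -- a real vector `w = b` is non-isotropic
    refine false_of_mixed_curvature_eq_zero L hT hpos pa₁ (hn₂ a₂ ha₂) (horth a₁ a₂) (c := 0)
      (map_zero _) (map_zero _) ?_ ?_ (hmixed a₁ a₂) ?_
    · rw [hsymm, map_zero]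
    · refine iff_of_false hq ?_
      rw [map_zero (g p 0)]
      exact pa₂
    · exact fun y z => (hT.linear_second _ y z).map_zero

variable {E₁ : Type*} [NormedAddCommGroup E₁] [NormedSpace ℝ E₁] [FiniteDimensional ℝ E₁]
  {H₁ : Type*} [TopologicalSpace H₁]
  {I₁ : ModelWithCorners ℝ E₁ H₁} [I₁.Boundaryless]
  {N₁ : Type*} [TopologicalSpace N₁] [ChartedSpace H₁ N₁] [IsManifold I₁ ∞ N₁]
  {E₂ : Type*} [NormedAddCommGroup E₂] [NormedSpace ℝ E₂] [FiniteDimensional ℝ E₂]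
  {H₂ : Type*} [TopologicalSpace H₂]
  {I₂ : ModelWithCorners ℝ E₂ H₂} [I₂.Boundaryless]
  {N₂ : Type*} [TopologicalSpace N₂] [ChartedSpace H₂ N₂] [IsManifold I₂ ∞ N₂]

/-- In a Riemannian product, tangent vectors to the two factors are orthogonal. -/
theorem productMetric_inl_inr (g₁ : MetricField I₁ N₁) (g₂ : MetricField I₂ N₂) (x : N₁ × N₂)
    (a : E₁) (b : E₂) :
    productMetric g₁ g₂ x (LinearMap.inl ℝ E₁ E₂ a : E₁ × E₂) (LinearMap.inr ℝ E₁ E₂ b : E₁ × E₂) =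
      0 := by
  have e : productMetric g₁ g₂ x (LinearMap.inl ℝ E₁ E₂ a : E₁ × E₂)
      (LinearMap.inr ℝ E₁ E₂ b : E₁ × E₂) = g₁ x.1 a (0 : E₁) + g₂ x.2 (0 : E₂) b := rfl
  have e₁ : g₁ x.1 a (0 : E₁) = 0 := map_zero (g₁ x.1 a)
  have e₂ : g₂ x.2 (0 : E₂) b = 0 := (congrArg (fun F => F b) (map_zero (g₂ x.2))).trans rfl
  rw [e, e₁, e₂, add_zero]

/-- In a Riemannian product, the planes mixing the two factors are flat. -/
theorem riemannTensor_productMetric_inl_inr {g₁ : MetricField I₁ N₁} {g₂ : MetricField I₂ N₂}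
    {x : N₁ × N₂} (hg₁ : IsMetricOn (chartMetric g₁ x.1) (extChartAt I₁ x.1).target)
    (hg₂ : IsMetricOn (chartMetric g₂ x.2) (extChartAt I₂ x.2).target)
    (hT₁ : IsCurvatureForm (riemannTensor g₁ x.1)) (hT₂ : IsCurvatureForm (riemannTensor g₂ x.2))
    (a : E₁) (b : E₂) (y z : TangentSpace (I₁.prod I₂) x) :
    riemannTensor (productMetric g₁ g₂) x (LinearMap.inl ℝ E₁ E₂ a : E₁ × E₂)
      (LinearMap.inr ℝ E₁ E₂ b : E₁ × E₂) y z = 0 := by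
  have e₁ : riemannTensor g₁ x.1 a (0 : E₁) y.1 z.1 = 0 := (hT₁.linear_second a y.1 z.1).map_zero
  have e₂ : riemannTensor g₂ x.2 (0 : E₂) b y.2 z.2 = 0 := (hT₂.linear_first b y.2 z.2).map_zero
  refine (riemannTensor_productMetric hg₁ hg₂ _ _ _ _).trans ?_
  exact (congrArg₂ (· + ·) e₁ e₂).trans (add_zero 0)

/-- A bijective differential `D` of an isometry from a Riemannian product carries the splitting of
the tangent space of the product to one forbidden by `false_of_orthogonal_splitting`. -/
theorem false_of_productMetric {g : MetricField I M} {p : M}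
    {g₁ : MetricField I₁ N₁} {g₂ : MetricField I₂ N₂} {x : N₁ × N₂}
    (hg₁ : IsMetricOn (chartMetric g₁ x.1) (extChartAt I₁ x.1).target)
    (hg₂ : IsMetricOn (chartMetric g₂ x.2) (extChartAt I₂ x.2).target)
    (hT₁ : IsCurvatureForm (riemannTensor g₁ x.1)) (hT₂ : IsCurvatureForm (riemannTensor g₂ x.2))
    (h₁ : 0 < Module.finrank ℝ E₁) (h₂ : 0 < Module.finrank ℝ E₂)
    (hsymm : ∀ a b, g p a b = g p b a) (hgpos : ∀ a, a ≠ 0 → 0 < g p a a)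
    (L : TangentIsometry g p n) (hT : IsCurvatureForm (riemannTensor g p)) {e u : Fin n → ℂ}
    (he : e ⬝ᵥ e ≠ 0) (heu : e ⬝ᵥ u = 0) (hu : u ≠ 0)
    (hpos : ∀ v w : Fin n → ℂ, v ⬝ᵥ v ≠ 0 → v ⬝ᵥ w = 0 → w ≠ 0 → (u ⬝ᵥ u = 0 ↔ w ⬝ᵥ w = 0) →
      0 < (soInner (curvatureOperator L (simpleElement v w)) (simpleElement v w)).re)
    (D : E₁ × E₂ →ₗ[ℝ] TangentSpace I p) (hD : Function.Bijective D)
    (hiso : ∀ a b : E₁ × E₂, g p (D a) (D b) = productMetric g₁ g₂ x a b)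
    (hcurv : ∀ a b c d : E₁ × E₂, riemannTensor g p (D a) (D b) (D c) (D d) =
      riemannTensor (productMetric g₁ g₂) x a b c d) : False := by
  refine false_of_orthogonal_splitting hsymm hgpos L hT he heu hu hpos h₁ h₂
    (D ∘ₗ LinearMap.inl ℝ E₁ E₂) (D ∘ₗ LinearMap.inr ℝ E₁ E₂)
    (hD.1.comp LinearMap.inl_injective) (hD.1.comp LinearMap.inr_injective) ?_ ?_ ?_
  · intro y
    obtain ⟨y, rfl⟩ := hD.2 y
    refine ⟨y.1, y.2, ?_⟩
    rw [LinearMap.comp_apply, LinearMap.comp_apply, ← map_add]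
    simp
  · intro a b
    rw [LinearMap.comp_apply, LinearMap.comp_apply, hiso]
    exact productMetric_inl_inr g₁ g₂ x a b
  · intro a b y z
    obtain ⟨y, rfl⟩ := hD.2 y
    obtain ⟨z, rfl⟩ := hD.2 z
    rw [LinearMap.comp_apply, LinearMap.comp_apply, hcurv]
    exact riemannTensor_productMetric_inl_inr hg₁ hg₂ hT₁ hT₂ a b y z

end Irreducibility

/-- A local isometry from a Riemannian product into `M` would transport the flat mixed planes of the
product to `M`. -/
theorem isLocallyIrreducible_of_pos {n : ℕ} {M : Type u} [TopologicalSpace M]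
    [ChartedSpace (EuclideanSpace ℝ (Fin n)) M] [IsManifold (𝓡 n) ∞ M]
    (g : SmoothMetric n M) {e u : Fin n → ℂ} (he : e ⬝ᵥ e ≠ 0) (heu : e ⬝ᵥ u = 0) (hu : u ≠ 0)
    (h : ∀ p, ∃ L : TangentIsometry g.inner p n, ∀ v w : Fin n → ℂ, v ⬝ᵥ v ≠ 0 → v ⬝ᵥ w = 0 →
      w ≠ 0 → (u ⬝ᵥ u = 0 ↔ w ⬝ᵥ w = 0) →
      0 < (soInner (curvatureOperator L (simpleElement v w)) (simpleElement v w)).re) :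
    IsLocallyIrreducible.{u, v, w} g := by
  intro k l N₁ N₂ _ _ _ _ _ _ _ _ g₁ g₂ f hk hl hf
  obtain ⟨-, hdiff, hiso⟩ := hf
  have hg := isMetricOn_chartMetric g
  have hg₁ := isMetricOn_chartMetric g₁
  have hg₂ := isMetricOn_chartMetric g₂
  have hbij : ∀ x, Function.Bijective (mfderiv ((𝓡 k).prod (𝓡 l)) (𝓡 n) f x) := fun x =>
    ((hdiff x).mfderivToContinuousLinearEquiv (by simp)).bijective
  obtain ⟨x⟩ : Nonempty (N₁ × N₂) := inferInstance
  have hprod : ∀ x : N₁ × N₂, IsMetricOn (chartMetric (productMetric g₁.inner g₂.inner) x)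
      (extChartAt ((𝓡 k).prod (𝓡 l)) x).target := fun x => (hg₁ x.1).chartMetric_prod (hg₂ x.2)
  have hnat := riemannTensor_mfderiv (I := 𝓡 n) (I' := (𝓡 k).prod (𝓡 l)) (g := g.inner)
    (h := productMetric g₁.inner g₂.inner) hg hprod hdiff.contMDiff (fun x => (hbij x).2) hiso x
  obtain ⟨L, hL⟩ := h (f x)
  exact false_of_productMetric (g := g.inner) (g₁ := g₁.inner) (g₂ := g₂.inner)
    (hg₁ x.1) (hg₂ x.2) (isCurvatureForm_riemannTensor (hg₁ x.1))
    (isCurvatureForm_riemannTensor (hg₂ x.2)) (hk.trans_eq finrank_euclideanSpace_fin.symm)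
    (hl.trans_eq finrank_euclideanSpace_fin.symm) (g.symm (f x)) (g.pos (f x)) L
    (isCurvatureForm_riemannTensor (hg (f x))) he heu hu hL
    (mfderiv ((𝓡 k).prod (𝓡 l)) (𝓡 n) f x).toLinearMap (hbij x) (hiso x) hnat

theorem mainTheorem4 {n : ℕ} {M : Type u} [TopologicalSpace M]
    [ChartedSpace (EuclideanSpace ℝ (Fin n)) M] [IsManifold (𝓡 n) ∞ M]
    (g : SmoothMetric n M)
    (S : Set (Matrix (Fin n) (Fin n) ℂ))
    (hS : ∀ X ∈ S, X ∈ LieAlgebra.Orthogonal.so (Fin n) ℂ)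
    (hinv : IsAdInvariant S)
    (hsimple : ∃ (e : Fin n → ℝ) (u : Fin n → ℂ),
      (fun i => (e i : ℂ)) ⬝ᵥ u = 0 ∧
      simpleElement (fun i => (e i : ℂ)) u ≠ 0 ∧
      simpleElement (fun i => (e i : ℂ)) u ∈ S)
    (hpos : HasPositiveCurvatureOn S g.inner) :
    HasNonnegIsotropicCurvature (n + 1) (productMetric g.inner lineMetric) ∧
      IsLocallyIrreducible.{u, v, w} g := by
  obtain ⟨e, u, heu, hne, heS⟩ := hsimple
  have he : (fun i => (e i : ℂ)) ⬝ᵥ (fun i => (e i : ℂ)) ≠ 0 := by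
    have h1 : (fun i => (e i : ℂ)) ⬝ᵥ (fun i => (e i : ℂ)) = ((e ⬝ᵥ e : ℝ) : ℂ) := by
      simp [dotProduct]
    rw [h1, Complex.ofReal_ne_zero]
    intro h0
    apply hne
    rw [dotProduct_self_eq_zero.1 h0]
    ext i j
    simp [simpleElement, Matrix.vecMulVec_apply]
  have hu : u ≠ 0 := by
    rintro rfl
    apply hne
    simp [simpleElement]
  constructor
  · refine hasNonnegIsotropicCurvature_productMetric_lineMetric (isMetricOn_chartMetric g)
      fun p => ?_
    obtain ⟨L, hL⟩ := hpos p
    exact ⟨L, fun v w hv hvw => nonneg_simpleElement_of_isAdInvariant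
      (F := fun X => (soInner (curvatureOperator L X) X).re)
      (continuous_re_soInner_curvatureOperator L) (re_soInner_curvatureOperator_smul L) hinv hL he
      heu hu heS hv hvw⟩
  · refine isLocallyIrreducible_of_pos g he heu hu fun p => ?_
    obtain ⟨L, hL⟩ := hpos p
    exact ⟨L, fun v w hv hvw hw huw => pos_simpleElement_of_isAdInvariant
      (F := fun X => (soInner (curvatureOperator L X) X).re)
      (re_soInner_curvatureOperator_smul L) hinv hL he heu hu heS hv hvw hw huw⟩
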